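/- Let $k$ be a field of characteristic zero, $R=k[x_1,x_2,x_3]$ with the standard grading, and let $A=R/I$ be an artinian algebra of codimension 3, i.e. $I$ is a proper homogeneous ideal of $R$ containing no nonzero linear form and $A$ is artinian. Write $h(A)=(h_0,\dots,h_c)$, $h_i=\dim_k A_i$, with $c$ the last index with $h_c>0$, for the $h$-vector of $A$, and $e=\dim_k A$ for its multiplicity. For $d\ge 0$ put $N(3,d)=\dim_k R_d=\binom{d+2}{d}$. For an artinian algebra $B=R/J$ of codimension 3 with $h$-vector $(h_0(B),\dots,h_{c}(B))$, $h_c(B)>0$, and socle-vector $s=(s_0,\dots,s_c)$, where $s_i=\dim_k \mathrm{soc}(B)_i$ and $\mathrm{soc}(B)$ is the annihilator of $(\overline{x_1},\overline{x_2},\overline{x_3})$ in $B$, put $$r_d=N(3,d)-\sum_{j=d}^{c}N(3,j-d)\,s_j\qquad(0\le d\le c),$$ and let $b$ be the unique index with $1\le b\le c$, $r_b\ge 0$ and $r_{b-1}<0$. The algebra $B$ is called compressed if $s_1=\dots=s_{b-1}=0$ and $h_i(B)=\min\{N(3,i)-r_i,\;N(3,i)\}$ for all $0\le i\le c$. Theorem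 2.7. Suppose that $h(A)$ is the $h$-vector of some compressed algebra $B=R/J$ of codimension 3. Let $$0\to F_3\to F_2\to F_1\to R\to A\to 0$$ be the graded minimal free resolution of $A$ over $R$, where each $F_i$ is a nonzero finite direct sum of modules $R(-j)$, and let $m_i$ and $M_i$ be the smallest and the largest shift $j$ occurring in $F_i$ ($i=1,2,3$). Then $$\frac{m_1m_2m_3}{6}\le e\le\frac{M_1M_2M_3}{6}.$$ -/

import Mathlib

open scoped BigOperators

namespace GradedArtinian

/-- The degree `i` component `A_i` of `A = k[x_1, …, x_r] / I`, for a homogeneous ideal `I`: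
the image in `A` of the forms of degree `i`. -/
noncomputable def component {k : Type*} [Field k] {r : ℕ} (I : Ideal (MvPolynomial (Fin r) k))
    (i : ℕ) : Submodule k (MvPolynomial (Fin r) k ⧸ I) :=
  (MvPolynomial.homogeneousSubmodule (Fin r) k i).map (Ideal.Quotient.mkₐ k I).toLinearMap

/-- The `h`-vector of `A`: `h_i = dim_k A_i`. -/
noncomputable def hVector {k : Type*} [Field k] {r : ℕ} (I : Ideal (MvPolynomial (Fin r) k))
    (i : ℕ) : ℕ :=
  Module.finrank k (component I i)

/-- The socle of `A`: the elements annihilated by the classes of all the variables, that is,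
by the maximal homogeneous ideal of `A`. -/
def socle {k : Type*} [Field k] {r : ℕ} (I : Ideal (MvPolynomial (Fin r) k)) :
    Submodule k (MvPolynomial (Fin r) k ⧸ I) where
  carrier := {a | ∀ j : Fin r, a * Ideal.Quotient.mk I (MvPolynomial.X j) = 0}
  zero_mem' := by
    intro j
    simp
  add_mem' := by
    intro a b ha hb j
    rw [add_mul, ha j, hb j, add_zero]
  smul_mem' := by
    intro t a ha j
    rw [smul_mul_assoc, ha j, smul_zero]

/-- The socle-vector of `A`: `s_i = dim_k soc(A)_i`. -/
noncomputable def socleVector {k : Type*} [Field k] {r : ℕ}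
    (I : Ideal (MvPolynomial (Fin r) k)) (i : ℕ) : ℕ :=
  Module.finrank k (component I i ⊓ socle I : Submodule k (MvPolynomial (Fin r) k ⧸ I))

/-- The multiplicity of the artinian algebra `A`, its dimension as a `k`-vector space. -/
noncomputable def multiplicity {k : Type*} [Field k] {r : ℕ}
    (I : Ideal (MvPolynomial (Fin r) k)) : ℕ :=
  Module.finrank k (MvPolynomial (Fin r) k ⧸ I)

/-- `k[x_1, …, x_r] / I` is a standard graded artinian `k`-algebra of codimension `r`:
`I` is a proper homogeneous ideal, the quotient is artinian, and `h_1 = r`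
(equivalently, `I` contains no nonzero linear form). -/
structure IsArtinianAlgebra {k : Type*} [Field k] {r : ℕ}
    (I : Ideal (MvPolynomial (Fin r) k)) : Prop where
  /-- `I` is homogeneous: it contains the homogeneous components of its elements -/
  homogeneous : ∀ f ∈ I, ∀ i : ℕ, MvPolynomial.homogeneousComponent i f ∈ I
  ne_top : I ≠ ⊤
  artinian : IsArtinianRing (MvPolynomial (Fin r) k ⧸ I)
  codim : hVector I 1 = r

/-- `N(r, d)`, the dimension of the space of forms of degree `d` in `r` variables. -/
def fullDim (r d : ℕ) : ℕ := (r + d - 1).choose d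

/-- The integers `r_d = N(r,d) - N(r,0) s_d - N(r,1) s_{d+1} - … - N(r,c-d) s_c` attached to a
codimension `r` and a socle-vector `s = (s_0, …, s_c)`. -/
def socleDefect (r c : ℕ) (s : ℕ → ℕ) (d : ℕ) : ℤ :=
  (fullDim r d : ℤ) - ∑ j ∈ Finset.Icc d c, (fullDim r (j - d) : ℤ) * (s j : ℤ)

/-- `A = k[x_1, …, x_r] / I` is a compressed algebra: with `s` its socle-vector, `c` its socle
degree, and `b` the index with `1 ≤ b ≤ c`, `r_b ≥ 0` and `r_{b-1} < 0`, one has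
`s_1 = … = s_{b-1} = 0` and `h_i = min (N(r,i) - r_i) (N(r,i))` for `i = 0, …, c`. -/
structure IsCompressed {k : Type*} [Field k] {r : ℕ}
    (I : Ideal (MvPolynomial (Fin r) k)) : Prop where
  algebra : IsArtinianAlgebra I
  exists_index : ∃ c b : ℕ,
    IsGreatest {i | 0 < hVector I i} c ∧
    1 ≤ b ∧ b ≤ c ∧
    0 ≤ socleDefect r c (socleVector I) b ∧
    socleDefect r c (socleVector I) (b - 1) < 0 ∧
    (∀ i, 1 ≤ i → i < b → socleVector I i = 0) ∧
    ∀ i ≤ c, (hVector I i : ℤ) =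
      min ((fullDim r i : ℤ) - socleDefect r c (socleVector I) i) (fullDim r i : ℤ)

/-- The element `v` of the graded free module `⨁ i, R(-a i)` is homogeneous of degree `d`:
each monomial occurring in the coordinate `v i` has degree `d - a i`. -/
def IsHomogeneousOfDegree {k : Type*} [Field k] {r n : ℕ} (a : Fin n → ℕ) (d : ℕ)
    (v : Fin n → MvPolynomial (Fin r) k) : Prop :=
  ∀ i m, (v i).coeff m ≠ 0 → m.degree + a i = d

/-- A (graded) minimal free resolution
`0 ⟶ F_3 ⟶ F_2 ⟶ F_1 ⟶ R ⟶ R/I ⟶ 0` over `R = k[x_1, x_2, x_3]`.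
The module `F_{i+1}` is `⨁ j, R(-(shift i j))`, of rank `rank i`, for `i = 0, 1, 2`. -/
structure MinimalFreeResolution {k : Type*} [Field k] (I : Ideal (MvPolynomial (Fin 3) k)) where
  rank : Fin 3 → ℕ
  /-- the shifts, listed with multiplicity -/
  shift : (i : Fin 3) → Fin (rank i) → ℕ
  d₁ : (Fin (rank 0) → MvPolynomial (Fin 3) k) →ₗ[MvPolynomial (Fin 3) k] MvPolynomial (Fin 3) k
  d₂ : (Fin (rank 1) → MvPolynomial (Fin 3) k) →ₗ[MvPolynomial (Fin 3) k]
    (Fin (rank 0) → MvPolynomial (Fin 3) k)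
  d₃ : (Fin (rank 2) → MvPolynomial (Fin 3) k) →ₗ[MvPolynomial (Fin 3) k]
    (Fin (rank 1) → MvPolynomial (Fin 3) k)
  /-- the maps are homogeneous of degree `0` -/
  d₁_degree : ∀ d v, IsHomogeneousOfDegree (shift 0) d v → (d₁ v).IsHomogeneous d
  d₂_degree : ∀ d v, IsHomogeneousOfDegree (shift 1) d v →
    IsHomogeneousOfDegree (shift 0) d (d₂ v)
  d₃_degree : ∀ d v, IsHomogeneousOfDegree (shift 2) d v →
    IsHomogeneousOfDegree (shift 1) d (d₃ v)
  /-- exactness -/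
  range_d₁ : LinearMap.range d₁ = I
  exact₁ : Function.Exact d₂ d₁
  exact₂ : Function.Exact d₃ d₂
  injective_d₃ : Function.Injective d₃
  /-- minimality: the image of each map lies in `(x_1, x_2, x_3)` times its target -/
  minimal₁ : ∀ v, MvPolynomial.constantCoeff (d₁ v) = 0
  minimal₂ : ∀ v i, MvPolynomial.constantCoeff (d₂ v i) = 0
  minimal₃ : ∀ v i, MvPolynomial.constantCoeff (d₃ v i) = 0

end GradedArtinian

/-! The algebra A need not be compressed: only its h-vector h is. Since h is the Euler
characteristic of the resolution degree by degree, its third difference at x ≠ 0 is -β₁(x) + β₂(x) -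
β₃(x), where βᵢ(x) counts the shifts x in Fᵢ. Signs of third differences therefore detect shifts.

Compressedness gives h_i = N(i) for i < b and h_i = ∑ s_j N(j-i) for i ≥ b. Hence b ≤ m₁. The third
difference at b+2 equals -r_{b-1} > 0, so b+2 is a shift of F₂ and m₂ ≤ b+2 ≤ m₁+2, M₂ ≥ b+2. The
top degree c consists of socle, so c+3 is a shift of F₃.

Upper bound: 6e is an explicit cubic sum in the s_j. Replacing one linear factor by its maximum
leaves a sum controlled by r_b ≥ 0, so 6e ≤ (b+1)(b+2)(c+3), which suffices if M₁ > b. Otherwise M₁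
= m₁ = b, F₁ and F₃ have no shift b+1, and β₂(b+1) ≥ 0 sharpens the estimate to b(b+2)(c+3).

Lower bound: socle elements of degree i produce shifts i+3 in F₃, so A has no socle below degree p =
m₃-3. A leading-monomial count turns this into (p-i)h_i ≤ (p-i+2)h_{i+1} for i < p (`finrank_decay`,
`MinimalFreeResolution.hVector_decay`). Telescoping bounds ∑_{i≥j} h_i below by a multiple of h_j.
With j = m₁-1 or j = m₁, according to whether m₂ is m₁+1 or m₁+2, this gives 6e ≥ m₁m₂m₃. -/

namespace GradedArtinian

/-! ### Leading spaces of an ordered family of linear maps -/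

section Leading

variable {k U W ι : Type*} [Field k] [AddCommGroup U] [Module k U] [AddCommGroup W] [Module k W]

/-- The common kernel of the maps `φ ν`, `ν ∈ P`. -/
def commonKer (φ : ι → U →ₗ[k] W) (P : Finset ι) : Submodule k U :=
  ⨅ ν ∈ P, LinearMap.ker (φ ν)

theorem mem_commonKer {φ : ι → U →ₗ[k] W} {P : Finset ι} {u : U} :
    u ∈ commonKer φ P ↔ ∀ ν ∈ P, φ ν u = 0 := by
  simp [commonKer]

/-- The leading coefficients at `μ`: the values of `φ μ` on the vectors killed by all `φ ν` with
`ν ∈ S` of smaller key. -/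
def leading (φ : ι → U →ₗ[k] W) (key : ι → ℕ) (S : Finset ι) (μ : ι) : Submodule k W :=
  (commonKer φ (S.filter fun ν => key ν < key μ)).map (φ μ)

theorem finrank_map_add_finrank_inf_ker (f : U →ₗ[k] W) (K : Submodule k U)
    [FiniteDimensional k K] :
    Module.finrank k (K.map f) + Module.finrank k (K ⊓ LinearMap.ker f : Submodule k U) =
      Module.finrank k K := by
  have h := LinearMap.finrank_range_add_finrank_ker (f.domRestrict K)
  have h' := Submodule.finrank_map_subtype_eq K ((LinearMap.ker f).comap K.subtype)
  rw [Submodule.map_comap_subtype] at h'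
  rw [LinearMap.range_domRestrict, LinearMap.ker_domRestrict] at h
  rw [h']
  exact h

/-- Peel off the map of largest key: by injectivity of the key all other maps come strictly before
it, so its leading space is its image on their common kernel, and rank-nullity applies there. -/
theorem sum_finrank_leading [FiniteDimensional k U] (φ : ι → U →ₗ[k] W) (key : ι → ℕ)
    (S : Finset ι) (hkey : Set.InjOn key S) :
    ∑ μ ∈ S, Module.finrank k (leading φ key S μ) + Module.finrank k (commonKer φ S) =
      Module.finrank k U := by
  classical
  induction S using Finset.induction_on_max_value key with
  | empty =>
    have h : commonKer φ ∅ = ⊤ := by ext; simp [mem_commonKer]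
    rw [h, Finset.sum_empty, finrank_top, zero_add]
  | insert a s ha hmax ih =>
    have hs : Set.InjOn key s := hkey.mono (by simp)
    rw [Finset.sum_insert ha, ← ih hs]
    have h1 : ∀ μ ∈ s, leading φ key (insert a s) μ = leading φ key s μ := by
      intro μ hμ
      rw [leading, leading, Finset.filter_insert, if_neg (by simpa using hmax μ hμ)]
    have h2 : leading φ key (insert a s) a = (commonKer φ s).map (φ a) := by
      rw [leading, Finset.filter_insert, if_neg (lt_irrefl _), Finset.filter_true_of_mem]
      intro x hx
      refine lt_of_le_of_ne (hmax x hx) fun h => ha ?_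
      have := hkey (by simp [hx]) (by simp) h
      rwa [← this]
    have h3 : commonKer φ (insert a s) = commonKer φ s ⊓ LinearMap.ker (φ a) := by
      ext u
      simp only [mem_commonKer, Submodule.mem_inf, LinearMap.mem_ker, Finset.forall_mem_insert]
      exact and_comm
    rw [Finset.sum_congr rfl fun μ hμ => by rw [h1 μ hμ], h2, h3,
      ← finrank_map_add_finrank_inf_ker (φ a) (commonKer φ s)]
    ring

end Leading

/-! ### Growth estimate by counting leading monomials -/

section Decay

/-- The exponents of the monomials of degree `t` in three variables. -/
def exponents (t : ℕ) : Finset (Fin 3 → ℕ) := Finset.piAntidiag Finset.univ t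

theorem mem_exponents {t : ℕ} {μ : Fin 3 → ℕ} : μ ∈ exponents t ↔ ∑ j, μ j = t := by
  simp [exponents]

/-- An additive key that separates the exponents of a fixed degree at most `t`. -/
def lexKey (t : ℕ) (μ : Fin 3 → ℕ) : ℕ := μ 0 * (t + 1) + μ 1

theorem lexKey_injOn {t s : ℕ} (hs : s ≤ t) : Set.InjOn (lexKey t) (exponents s) := by
  intro μ hμ ν hν h
  simp only [Finset.mem_coe, mem_exponents, Fin.sum_univ_three] at hμ hν
  simp only [lexKey] at h
  -- Both second exponents are at most t, so the key is a two-digit number in base t+1; the third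
  -- exponent is then fixed by the degree.
  have h0 : μ 0 = ν 0 := by
    have e1 : (μ 0 * (t + 1) + μ 1) / (t + 1) = μ 0 := by
      rw [mul_comm, Nat.mul_add_div (by omega), Nat.div_eq_of_lt (by omega), add_zero]
    have e2 : (ν 0 * (t + 1) + ν 1) / (t + 1) = ν 0 := by
      rw [mul_comm, Nat.mul_add_div (by omega), Nat.div_eq_of_lt (by omega), add_zero]
    rw [← e1, ← e2, h]
  rw [h0] at h
  have h1 : μ 1 = ν 1 := by omega
  ext j
  fin_cases j
  · exact h0
  · exact h1
  · simp only [Fin.reduceFinMk]; omega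

theorem lexKey_add (t : ℕ) (μ ν : Fin 3 → ℕ) :
    lexKey t (μ + ν) = lexKey t μ + lexKey t ν := by
  simp only [lexKey, Pi.add_apply]; ring

variable {k A : Type*} [Field k] [CommRing A] [Algebra k A]

/-- Multiplication by the monomial with exponent `μ` in `x`, on a subspace of `A`. -/
def monomialMul (x : Fin 3 → A) (U : Submodule k A) (μ : Fin 3 → ℕ) : U →ₗ[k] A :=
  (LinearMap.mulLeft k (∏ j, x j ^ μ j)).comp U.subtype

theorem monomialMul_apply (x : Fin 3 → A) (U : Submodule k A) (μ : Fin 3 → ℕ) (u : U) :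
    monomialMul x U μ u = (∏ j, x j ^ μ j) * (u : A) := rfl

theorem monomial_add_single (x : Fin 3 → A) (ν : Fin 3 → ℕ) (j : Fin 3) :
    ∏ i, x i ^ (ν + Pi.single j 1 : Fin 3 → ℕ) i = (∏ i, x i ^ ν i) * x j := by
  simp only [Pi.add_apply, pow_add, Finset.prod_mul_distrib]
  congr 1
  rw [Finset.prod_eq_single j]
  · simp
  · intro i _ hi; simp [Pi.single_eq_of_ne hi]
  · simp

/-- If u has leading monomial ν + e_j, then x_j u has leading monomial ν with the same leading
coefficient: the key is additive, so adding e_j preserves comparisons. -/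
theorem leading_add_single_le (x : Fin 3 → A) {U U' : Submodule k A}
    (hx : ∀ j, ∀ u ∈ U, x j * u ∈ U') (t T : ℕ) (ν : Fin 3 → ℕ) (j : Fin 3) :
    leading (monomialMul x U) (lexKey T) (exponents (t + 1)) (ν + Pi.single j 1 : Fin 3 → ℕ) ≤
      leading (monomialMul x U') (lexKey T) (exponents t) ν := by
  rintro _ ⟨u, hu, rfl⟩
  refine ⟨⟨x j * u, hx j u u.2⟩, ?_, ?_⟩
  · rw [SetLike.mem_coe, mem_commonKer] at hu ⊢
    intro μ hμ
    rw [Finset.mem_filter, mem_exponents] at hμ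
    have := hu (μ + Pi.single j 1) (by
      rw [Finset.mem_filter, mem_exponents, lexKey_add, lexKey_add]
      refine ⟨?_, by omega⟩
      simp [Finset.sum_add_distrib, hμ.1])
    rw [monomialMul_apply, monomial_add_single] at this
    rw [monomialMul_apply]
    simpa [mul_assoc] using this
  · rw [monomialMul_apply, monomialMul_apply, monomial_add_single]
    simp [mul_assoc]

theorem sum_exponents_succ (t : ℕ) (j : Fin 3) (f : (Fin 3 → ℕ) → ℕ) :
    ∑ μ ∈ exponents (t + 1), μ j * f μ =
      ∑ ν ∈ exponents t, (ν j + 1) * f (ν + Pi.single j 1) := by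
  symm
  refine Finset.sum_of_injOn (fun ν => ν + Pi.single j 1) ?_ ?_ ?_ ?_
  · intro a _ b _ h
    exact add_right_cancel h
  · intro ν hν
    rw [Finset.mem_coe, mem_exponents] at hν ⊢
    simp [Finset.sum_add_distrib, hν]
  · intro μ hμ h
    rcases Nat.eq_zero_or_pos (μ j) with h0 | h0
    · simp [h0]
    · exfalso
      apply h
      have hμ' : μ - Pi.single j 1 + Pi.single j 1 = μ := by
        ext i
        by_cases hi : i = j
        · subst hi; simp; omega
        · simp [Pi.single_eq_of_ne hi]
      refine ⟨μ - Pi.single j 1, ?_, hμ'⟩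
      rw [Finset.mem_coe, mem_exponents]
      rw [mem_exponents, ← hμ'] at hμ
      simpa [Finset.sum_add_distrib] using hμ
  · intro ν _
    simp

/-- If multiplication by the linear forms carries `U` to `U'`, and no nonzero element of `U` is
killed by all monomials of degree `t + 1`, then `(t + 1) dim U ≤ (t + 3) dim U'`. -/
theorem finrank_decay (x : Fin 3 → A) {U U' : Submodule k A} [FiniteDimensional k U]
    [FiniteDimensional k U'] (hx : ∀ j, ∀ u ∈ U, x j * u ∈ U') (t : ℕ)
    (hU : ∀ u ∈ U, (∀ μ ∈ exponents (t + 1), (∏ j, x j ^ μ j) * u = 0) → u = 0) :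
    (t + 1) * Module.finrank k U ≤ (t + 3) * Module.finrank k U' := by
  set ℓ : (Fin 3 → ℕ) → ℕ := fun μ => Module.finrank k
    (leading (monomialMul x U) (lexKey (t + 1)) (exponents (t + 1)) μ) with hℓ
  -- The key with parameter t+1 serves in both degrees, so that the order in degree t is compatible
  -- with multiplication by a variable.
  set ℓ' : (Fin 3 → ℕ) → ℕ := fun μ => Module.finrank k
    (leading (monomialMul x U') (lexKey (t + 1)) (exponents t) μ) with hℓ'
  have hfin : ∀ μ, FiniteDimensional k
      (leading (monomialMul x U') (lexKey (t + 1)) (exponents t) μ) := by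
    intro μ
    rw [leading]
    infer_instance
  have h1 : ∑ μ ∈ exponents (t + 1), ℓ μ = Module.finrank k U := by
    have h := sum_finrank_leading (monomialMul x U) (lexKey (t + 1)) (exponents (t + 1))
      (lexKey_injOn le_rfl)
    have h0 : commonKer (monomialMul x U) (exponents (t + 1)) = ⊥ := by
      rw [eq_bot_iff]
      intro u hu
      rw [mem_commonKer] at hu
      rw [Submodule.mem_bot]
      exact Subtype.ext (hU u u.2 hu)
    rw [h0, finrank_bot, add_zero] at h
    exact h
  have h2 : ∑ ν ∈ exponents t, ℓ' ν ≤ Module.finrank k U' := by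
    have h := sum_finrank_leading (monomialMul x U') (lexKey (t + 1)) (exponents t)
      (lexKey_injOn (Nat.le_succ t))
    exact h ▸ Nat.le_add_right _ _
  -- Double counting over pairs (ν, j): a monomial μ of degree t+1 has total weight ∑ μ_j = t+1,
  -- while ν of degree t receives ∑ (ν_j + 1) = t+3.
  calc (t + 1) * Module.finrank k U
      = ∑ μ ∈ exponents (t + 1), (∑ j, μ j) * ℓ μ := by
        rw [← h1, Finset.mul_sum]
        exact Finset.sum_congr rfl fun μ hμ => by rw [mem_exponents.1 hμ]
    _ = ∑ j, ∑ μ ∈ exponents (t + 1), μ j * ℓ μ := by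
        rw [Finset.sum_comm]
        exact Finset.sum_congr rfl fun μ _ => by rw [Finset.sum_mul]
    _ = ∑ j : Fin 3, ∑ ν ∈ exponents t, (ν j + 1) * ℓ (ν + Pi.single j 1) :=
        Finset.sum_congr rfl fun j _ => sum_exponents_succ t j ℓ
    _ ≤ ∑ j : Fin 3, ∑ ν ∈ exponents t, (ν j + 1) * ℓ' ν := by
        gcongr with j _ ν _
        have := hfin ν
        exact Submodule.finrank_mono (leading_add_single_le x hx t (t + 1) ν j)
    _ = ∑ ν ∈ exponents t, (∑ j : Fin 3, (ν j + 1)) * ℓ' ν := by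
        rw [Finset.sum_comm]
        exact Finset.sum_congr rfl fun μ _ => by rw [Finset.sum_mul]
    _ = (t + 3) * ∑ ν ∈ exponents t, ℓ' ν := by
        rw [Finset.mul_sum]
        refine Finset.sum_congr rfl fun μ hμ => ?_
        rw [Finset.sum_add_distrib, mem_exponents.1 hμ]
        simp
    _ ≤ (t + 3) * Module.finrank k U' := Nat.mul_le_mul_left _ h2

end Decay

end GradedArtinian

namespace GradedArtinian

/-! ### Dimensions of spaces of forms, with integer argument -/

section FormsDim

/-- The dimension of the space of forms of degree `x` in three variables, for an integer `x`. -/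
def formsDim (x : ℤ) : ℤ := ((x + 2).toNat.choose 2 : ℕ)

theorem formsDim_of_neg {x : ℤ} (hx : x < 0) : formsDim x = 0 := by
  rw [formsDim, Nat.choose_eq_zero_of_lt (by omega), Nat.cast_zero]

/-- The polynomial formula persists at -1 and -2, its two roots; third differences at positive
arguments and the edge cases of the later estimates need these values. -/
theorem two_mul_formsDim {x : ℤ} (hx : -2 ≤ x) : 2 * formsDim x = (x + 1) * (x + 2) := by
  obtain ⟨n, hn⟩ := Int.eq_ofNat_of_zero_le (show 0 ≤ x + 2 by omega)
  have h1 : n.choose 2 * 2 = n * (n - 1) := by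
    rw [Nat.choose_two_right, Nat.div_mul_cancel (Nat.even_mul_pred_self n).two_dvd]
  have h2 : (n : ℤ) * ((n - 1 : ℕ) : ℤ) = n * (n - 1) := by
    cases n <;> simp
  rw [formsDim, hn, Int.toNat_natCast, mul_comm]
  calc ((n.choose 2 : ℕ) : ℤ) * 2 = (n : ℤ) * ((n - 1 : ℕ) : ℤ) := by exact_mod_cast h1
    _ = (x + 1) * n := by rw [h2, ← hn]; ring

theorem formsDim_nonneg (x : ℤ) : 0 ≤ formsDim x := by
  rw [formsDim]; positivity

theorem formsDim_mono {x y : ℤ} (h : x ≤ y) : formsDim x ≤ formsDim y := by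
  rw [formsDim, formsDim]
  exact_mod_cast Nat.choose_le_choose 2 (by omega)

theorem fullDim_three (d : ℕ) : (fullDim 3 d : ℤ) = formsDim d := by
  rw [fullDim, formsDim, show 3 + d - 1 = d + 2 by omega,
    show ((d : ℤ) + 2).toNat = d + 2 by omega, Nat.choose_symm_add]

/-- The third difference of `formsDim` is the indicator function of `0`. -/
theorem formsDim_third_difference (x : ℤ) :
    formsDim x - 3 * formsDim (x - 1) + 3 * formsDim (x - 2) - formsDim (x - 3) =
      if x = 0 then 1 else 0 := by
  rcases lt_trichotomy x 0 with h | h | h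
  · rw [if_neg h.ne, formsDim_of_neg h, formsDim_of_neg (by omega), formsDim_of_neg (by omega),
      formsDim_of_neg (by omega)]
    norm_num
  · subst h
    rw [if_pos rfl, formsDim_of_neg (x := 0 - 1) (by norm_num),
      formsDim_of_neg (x := 0 - 2) (by norm_num), formsDim_of_neg (x := 0 - 3) (by norm_num)]
    decide
  · rw [if_neg h.ne']
    have h0 := two_mul_formsDim (x := x) (by omega)
    have h1 := two_mul_formsDim (x := x - 1) (by omega)
    have h2 := two_mul_formsDim (x := x - 2) (by omega)
    have h3 := two_mul_formsDim (x := x - 3) (by omega)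
    linarith

end FormsDim

/-! ### Graded pieces of free modules -/

section Pieces

open MvPolynomial

variable {k : Type*} [Field k] {n n' n'' : ℕ}

theorem card_exponents_degree (a d : ℕ) :
    (Nat.card {m : Fin 3 →₀ ℕ // m.degree + a = d} : ℤ) = formsDim ((d : ℤ) - a) := by
  by_cases h : a ≤ d
  · have e : ∀ m : Fin 3 →₀ ℕ, m.degree + a = d ↔
        m ∈ (Finset.univ : Finset (Fin 3)).finsuppAntidiag (d - a) := by
      intro m
      rw [Finset.mem_finsuppAntidiag, and_iff_left (Finset.subset_univ _),
        ← Finsupp.degree_eq_sum]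
      omega
    rw [Nat.card_congr (Equiv.subtypeEquivRight e), Nat.card_eq_fintype_card, Fintype.card_coe,
      Finset.card_finsuppAntidiag_nat_eq_choose, formsDim, Finset.card_univ, Fintype.card_fin,
      show ((d : ℤ) - a + 2).toNat = (d - a) + 2 by omega,
      show 3 + (d - a) - 1 = (d - a) + 2 by omega, Nat.choose_symm_add]
  · have : IsEmpty {m : Fin 3 →₀ ℕ // m.degree + a = d} := ⟨fun m => by have := m.2; omega⟩
    rw [Nat.card_of_isEmpty, formsDim_of_neg (by omega), Nat.cast_zero]

instance finite_exponents_degree (a d : ℕ) : Finite {m : Fin 3 →₀ ℕ | m.degree + a = d} := by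
  refine Set.Finite.subset
    ((Finset.univ : Finset (Fin 3)).finsuppAntidiag (d - a)).finite_toSet fun m hm => ?_
  rw [Set.mem_ofPred_eq] at hm
  rw [Finset.mem_coe, Finset.mem_finsuppAntidiag, ← Finsupp.degree_eq_sum]
  exact ⟨by omega, Finset.subset_univ _⟩

/-- The elements of `⨁ i, R(-a i)` that are homogeneous of degree `d`. -/
def gradedPiece (k : Type*) [Field k] (a : Fin n → ℕ) (d : ℕ) :
    Submodule k (Fin n → MvPolynomial (Fin 3) k) where
  carrier := {v | IsHomogeneousOfDegree a d v}
  zero_mem' := by intro i m h; simp at h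
  add_mem' := by
    intro v w hv hw i m h
    by_cases h1 : (v i).coeff m = 0
    · exact hw i m (by simpa [h1] using h)
    · exact hv i m h1
  smul_mem' := by
    intro t v hv i m h
    refine hv i m fun h1 => h ?_
    simp [h1]

/-- The homogeneous elements of a graded free module, coordinate by coordinate. -/
def gradedPieceEquiv (a : Fin n → ℕ) (d : ℕ) :
    gradedPiece k a d ≃ₗ[k]
      ∀ i, restrictSupport k {m : Fin 3 →₀ ℕ | m.degree + a i = d} where
  toFun v i := ⟨v.1 i, by
    rw [mem_restrictSupport_iff]
    intro m hm
    exact v.2 i m (by simpa using hm)⟩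
  invFun w := ⟨fun i => w i, by
    intro i m hm
    exact (mem_restrictSupport_iff ..).1 (w i).2 (by simpa using hm)⟩
  map_add' _ _ := rfl
  map_smul' _ _ := rfl
  left_inv _ := rfl
  right_inv _ := rfl

instance (a d : ℕ) :
    FiniteDimensional k (restrictSupport k {m : Fin 3 →₀ ℕ | m.degree + a = d}) :=
  Module.Basis.finiteDimensional_of_finite (basisRestrictSupport k _)

instance (a : Fin n → ℕ) (d : ℕ) : FiniteDimensional k (gradedPiece k a d) :=
  LinearEquiv.finiteDimensional (gradedPieceEquiv a d).symm

theorem finrank_gradedPiece (a : Fin n → ℕ) (d : ℕ) :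
    (Module.finrank k (gradedPiece k a d) : ℤ) = ∑ i, formsDim ((d : ℤ) - a i) := by
  rw [(gradedPieceEquiv a d).finrank_eq, Module.finrank_pi_fintype, Nat.cast_sum]
  refine Finset.sum_congr rfl fun i _ => ?_
  rw [Module.finrank_eq_nat_card_basis (basisRestrictSupport k _), ← card_exponents_degree]
  rfl

/-- The homogeneous component of degree `d` of an element of `⨁ i, R(-a i)`. -/
noncomputable def pieceComponent (a : Fin n → ℕ) (d : ℕ) :
    (Fin n → MvPolynomial (Fin 3) k) →ₗ[k] (Fin n → MvPolynomial (Fin 3) k) :=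
  LinearMap.pi fun i =>
    if a i ≤ d then (homogeneousComponent (d - a i)).comp (LinearMap.proj i) else 0

theorem coeff_pieceComponent (a : Fin n → ℕ) (d : ℕ) (v : Fin n → MvPolynomial (Fin 3) k)
    (i : Fin n) (m : Fin 3 →₀ ℕ) :
    (pieceComponent a d v i).coeff m = if m.degree + a i = d then (v i).coeff m else 0 := by
  rw [pieceComponent, LinearMap.pi_apply]
  by_cases h : a i ≤ d
  · rw [if_pos h, LinearMap.comp_apply, coeff_homogeneousComponent]
    exact if_congr (by omega) rfl rfl
  · rw [if_neg h, if_neg (by omega)]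
    simp

theorem pieceComponent_mem (a : Fin n → ℕ) (d : ℕ) (v : Fin n → MvPolynomial (Fin 3) k) :
    pieceComponent a d v ∈ gradedPiece k a d := by
  intro i m h
  rw [coeff_pieceComponent] at h
  by_contra h'
  exact h (if_neg h')

theorem pieceComponent_of_mem {a : Fin n → ℕ} {d : ℕ} {v : Fin n → MvPolynomial (Fin 3) k}
    (hv : v ∈ gradedPiece k a d) (d' : ℕ) :
    pieceComponent a d' v = if d' = d then v else 0 := by
  ext i m
  rw [coeff_pieceComponent]
  by_cases h0 : (v i).coeff m = 0
  · split_ifs <;> simp [h0]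
  · have := hv i m h0
    rw [this]
    split_ifs with h1 h2 h2
    · rfl
    · exact absurd h1.symm h2
    · exact absurd h2.symm h1
    · simp

theorem exists_sum_pieceComponent (a : Fin n → ℕ) (v : Fin n → MvPolynomial (Fin 3) k) (d : ℕ) :
    ∃ D, d < D ∧ v = ∑ d' ∈ Finset.range D, pieceComponent a d' v := by
  -- A crude bound exceeding d and every degree that occurs in v.
  refine ⟨d + 1 + ∑ i, ((v i).totalDegree + a i), by omega, ?_⟩
  ext i m
  rw [Finset.sum_apply, coeff_sum]
  simp only [coeff_pieceComponent]
  rw [Finset.sum_ite_eq]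
  split_ifs with h
  · rfl
  · by_contra h0
    apply h
    have h1 := le_totalDegree (mem_support_iff.2 h0)
    have h2 := Finset.single_le_sum (f := fun i => (v i).totalDegree + a i)
      (fun i _ => Nat.zero_le _) (Finset.mem_univ i)
    have h3 : m.degree = m.sum fun _ e => e := rfl
    rw [Finset.mem_range]
    omega

/-- Homogeneous maps of degree zero commute with taking homogeneous components. -/
theorem pieceComponent_map {a : Fin n → ℕ} {b : Fin n' → ℕ}
    (δ : (Fin n → MvPolynomial (Fin 3) k) →ₗ[MvPolynomial (Fin 3) k]
      (Fin n' → MvPolynomial (Fin 3) k))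
    (hδ : ∀ d v, IsHomogeneousOfDegree a d v → IsHomogeneousOfDegree b d (δ v))
    (d : ℕ) (v : Fin n → MvPolynomial (Fin 3) k) :
    pieceComponent b d (δ v) = δ (pieceComponent a d v) := by
  obtain ⟨D, hD, hv⟩ := exists_sum_pieceComponent a v d
  conv_lhs => rw [hv]
  rw [map_sum, map_sum, Finset.sum_eq_single d]
  · rw [pieceComponent_of_mem (hδ d _ (pieceComponent_mem a d v)), if_pos rfl]
  · intro d' _ hd'
    rw [pieceComponent_of_mem (hδ d' _ (pieceComponent_mem a d' v)), if_neg hd'.symm]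
  · intro h
    exact absurd (Finset.mem_range.2 hD) h

/-- In an exact sequence of homogeneous maps, the dimension of a graded piece of the middle term is
the sum of the dimensions of the images. -/
theorem finrank_gradedPiece_of_exact {a : Fin n → ℕ} {b : Fin n' → ℕ}
    {δ : (Fin n → MvPolynomial (Fin 3) k) →ₗ[MvPolynomial (Fin 3) k]
      (Fin n' → MvPolynomial (Fin 3) k)}
    (hδ : ∀ d v, IsHomogeneousOfDegree a d v → IsHomogeneousOfDegree b d (δ v))
    {W : Type*} [AddCommGroup W] [Module (MvPolynomial (Fin 3) k) W] [Module k W]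
    [IsScalarTower k (MvPolynomial (Fin 3) k) W]
    {ε : (Fin n' → MvPolynomial (Fin 3) k) →ₗ[MvPolynomial (Fin 3) k] W}
    (hex : Function.Exact δ ε) (d : ℕ) :
    Module.finrank k ((gradedPiece k b d).map (ε.restrictScalars k)) +
      Module.finrank k ((gradedPiece k a d).map (δ.restrictScalars k)) =
      Module.finrank k (gradedPiece k b d) := by
  have hker : (gradedPiece k a d).map (δ.restrictScalars k) =
      gradedPiece k b d ⊓ LinearMap.ker (ε.restrictScalars k) := by
    ext v
    rw [Submodule.mem_inf, Submodule.mem_map]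
    constructor
    · rintro ⟨u, hu, rfl⟩
      exact ⟨hδ d u hu, (hex _).2 ⟨u, rfl⟩⟩
    · rintro ⟨hv, h0⟩
      obtain ⟨u, rfl⟩ := (hex _).1 h0
      refine ⟨pieceComponent a d u, pieceComponent_mem a d u, ?_⟩
      rw [LinearMap.restrictScalars_apply, ← pieceComponent_map δ hδ, pieceComponent_of_mem hv,
        if_pos rfl]
  rw [hker, finrank_map_add_finrank_inf_ker (ε.restrictScalars k) (gradedPiece k b d)]

end Pieces

end GradedArtinian

namespace GradedArtinian

open MvPolynomial

/-! ### Exactness of the Koszul complex on three variables -/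

section Koszul

variable {k : Type*} [Field k] {n : ℕ}

theorem not_X_dvd_X {i j : Fin 3} (h : i ≠ j) :
    ¬ (X i : MvPolynomial (Fin 3) k) ∣ X j := fun hd => h (X_dvd_X.1 hd)

theorem X_dvd_of_mul_eq_mul {i j : Fin 3} (h : i ≠ j) {f g : MvPolynomial (Fin 3) k}
    (hfg : X i * f = X j * g) : X i ∣ g :=
  ((X_prime (i := i)).dvd_or_dvd ⟨f, hfg.symm⟩).resolve_left (not_X_dvd_X h)

/-- A polynomial without constant term is a combination of the variables. -/
theorem exists_eq_sum_X_mul {f : MvPolynomial (Fin 3) k} (hf : constantCoeff f = 0) :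
    ∃ p q r : MvPolynomial (Fin 3) k, f = X 0 * p + X 1 * q + X 2 * r := by
  set f₁ := f.modMonomial (Finsupp.single 0 1) with h₁
  set f₂ := f₁.modMonomial (Finsupp.single 1 1) with h₂
  set f₃ := f₂.modMonomial (Finsupp.single 2 1) with h₃
  have h0 : f₃ = 0 := by
    ext m
    rw [coeff_zero]
    by_cases hm2 : Finsupp.single 2 1 ≤ m
    · exact coeff_modMonomial_of_le _ hm2
    rw [h₃, coeff_modMonomial_of_not_le _ hm2]
    by_cases hm1 : Finsupp.single 1 1 ≤ m
    · exact coeff_modMonomial_of_le _ hm1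
    rw [h₂, coeff_modMonomial_of_not_le _ hm1]
    by_cases hm0 : Finsupp.single 0 1 ≤ m
    · exact coeff_modMonomial_of_le _ hm0
    rw [h₁, coeff_modMonomial_of_not_le _ hm0]
    have : m = 0 := by
      rw [Finsupp.single_le_iff] at hm0 hm1 hm2
      ext j
      fin_cases j <;> simp <;> omega
    rw [this]
    exact hf
  refine ⟨f.divMonomial (Finsupp.single 0 1), f₁.divMonomial (Finsupp.single 1 1),
    f₂.divMonomial (Finsupp.single 2 1), ?_⟩
  have e₁ := divMonomial_add_modMonomial_single f 0
  have e₂ := divMonomial_add_modMonomial_single f₁ 1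
  have e₃ := divMonomial_add_modMonomial_single f₂ 2
  rw [← h₁] at e₁
  rw [← h₂] at e₂
  rw [← h₃, h0] at e₃
  linear_combination -e₁ - e₂ - e₃

/-- A polynomial is congruent modulo the last variable to its value at `(x₁, x₂, 0)`. -/
theorem X_dvd_sub_aeval (f : MvPolynomial (Fin 3) k) :
    (X 2 : MvPolynomial (Fin 3) k) ∣ f - aeval ![X 0, X 1, 0] f := by
  have h : (Ideal.Quotient.mkₐ k (Ideal.span {(X 2 : MvPolynomial (Fin 3) k)})).comp
      (aeval ![X 0, X 1, 0]) = Ideal.Quotient.mkₐ k (Ideal.span {X 2}) := by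
    ext j
    fin_cases j
    · simp
    · simp
    · simp
  have h' := DFunLike.congr_fun h f
  rw [← Ideal.mem_span_singleton]
  exact Ideal.Quotient.eq.1 h'.symm

/-- Exactness of the Koszul complex at the linear syzygies of the variables. -/
theorem koszul_syzygy {a b c : MvPolynomial (Fin 3) k}
    (h : X 0 * a + X 1 * b + X 2 * c = 0) :
    ∃ t₀ t₁ t₂, a = X 1 * t₂ - X 2 * t₁ ∧ b = X 2 * t₀ - X 0 * t₂ ∧ c = X 0 * t₁ - X 1 * t₀ := by
  -- Setting the last variable to zero reduces to a syzygy of two coprime variables; the corrections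
  -- are multiples of the last variable.
  obtain ⟨a₁, ha⟩ := X_dvd_sub_aeval a
  obtain ⟨b₁, hb⟩ := X_dvd_sub_aeval b
  have h0 := congrArg (aeval ![X 0, X 1, (0 : MvPolynomial (Fin 3) k)]) h
  simp only [map_add, map_mul, aeval_X, map_zero, Matrix.cons_val_zero, Matrix.cons_val_one,
    Matrix.cons_val_two, Matrix.tail_cons, Matrix.head_cons, zero_mul,
    add_zero] at h0
  set a₀ := aeval ![X 0, X 1, (0 : MvPolynomial (Fin 3) k)] a
  set b₀ := aeval ![X 0, X 1, (0 : MvPolynomial (Fin 3) k)] b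
  obtain ⟨s, hs⟩ := X_dvd_of_mul_eq_mul (i := 1) (j := 0) (f := -b₀) (g := a₀) (by decide)
    (by linear_combination -h0)
  have hb0 : b₀ = - X 0 * s := by
    refine mul_left_cancel₀ (X_ne_zero (1 : Fin 3)) ?_
    linear_combination h0 - X 0 * hs
  have hc : c = -(X 0 * a₁) - X 1 * b₁ := by
    refine mul_left_cancel₀ (X_ne_zero (2 : Fin 3)) ?_
    linear_combination h - X 0 * ha - X 1 * hb - h0
  exact ⟨b₁, -a₁, s, by linear_combination ha + hs, by linear_combination hb + hb0,
    by linear_combination hc⟩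

theorem koszul_syzygy_pi {a b c : Fin n → MvPolynomial (Fin 3) k}
    (h : (X 0 : MvPolynomial (Fin 3) k) • a + (X 1 : MvPolynomial (Fin 3) k) • b +
      (X 2 : MvPolynomial (Fin 3) k) • c = 0) :
    ∃ t₀ t₁ t₂ : Fin n → MvPolynomial (Fin 3) k,
      a = (X 1 : MvPolynomial (Fin 3) k) • t₂ - (X 2 : MvPolynomial (Fin 3) k) • t₁ ∧
      b = (X 2 : MvPolynomial (Fin 3) k) • t₀ - (X 0 : MvPolynomial (Fin 3) k) • t₂ ∧
      c = (X 0 : MvPolynomial (Fin 3) k) • t₁ - (X 1 : MvPolynomial (Fin 3) k) • t₀ := by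
  choose t₀ t₁ t₂ h₀ h₁ h₂ using fun i => koszul_syzygy (a := a i) (b := b i) (c := c i)
    (by simpa using congrFun h i)
  exact ⟨t₀, t₁, t₂, funext h₀, funext h₁, funext h₂⟩

/-- Exactness of the Koszul complex at the vectors proportional to the variables. -/
theorem koszul_proportional {y₀ y₁ y₂ : MvPolynomial (Fin 3) k}
    (h₁ : X 0 * y₁ = X 1 * y₀) (h₂ : X 0 * y₂ = X 2 * y₀) :
    ∃ g, y₀ = X 0 * g ∧ y₁ = X 1 * g ∧ y₂ = X 2 * g := by
  obtain ⟨g, hg⟩ := X_dvd_of_mul_eq_mul (i := 0) (j := 1) (by decide) h₁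
  refine ⟨g, hg, mul_left_cancel₀ (X_ne_zero (0 : Fin 3)) ?_,
    mul_left_cancel₀ (X_ne_zero (0 : Fin 3)) ?_⟩
  · linear_combination h₁ + X 1 * hg
  · linear_combination h₂ + X 2 * hg

theorem koszul_proportional_pi {y₀ y₁ y₂ : Fin n → MvPolynomial (Fin 3) k}
    (h₁ : (X 0 : MvPolynomial (Fin 3) k) • y₁ = (X 1 : MvPolynomial (Fin 3) k) • y₀)
    (h₂ : (X 0 : MvPolynomial (Fin 3) k) • y₂ = (X 2 : MvPolynomial (Fin 3) k) • y₀) :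
    ∃ g : Fin n → MvPolynomial (Fin 3) k, y₀ = (X 0 : MvPolynomial (Fin 3) k) • g := by
  choose g h _ _ using fun i => koszul_proportional (y₀ := y₀ i) (y₁ := y₁ i) (y₂ := y₂ i)
    (by simpa using congrFun h₁ i) (by simpa using congrFun h₂ i)
  exact ⟨g, funext h⟩

end Koszul

/-! ### Homogeneous lifts and minimality -/

section Homogeneous

variable {k : Type*} [Field k] {n n' : ℕ}

theorem isHomogeneous_iff_degree {f : MvPolynomial (Fin 3) k} {d : ℕ} :
    f.IsHomogeneous d ↔ ∀ m, f.coeff m ≠ 0 → m.degree = d := by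
  rw [Finsupp.degree_eq_weight_one]
  exact Iff.rfl

theorem isHomogeneousOfDegree_const {f : MvPolynomial (Fin 3) k} {d : ℕ} :
    IsHomogeneousOfDegree (fun _ : Fin 1 => 0) d (fun _ => f) ↔ f.IsHomogeneous d := by
  rw [isHomogeneous_iff_degree]
  exact ⟨fun h m hm => h 0 m hm, fun h _ m hm => h m hm⟩

theorem IsHomogeneousOfDegree.X_smul {a : Fin n → ℕ} {d : ℕ} {v : Fin n → MvPolynomial (Fin 3) k}
    (hv : IsHomogeneousOfDegree a d v) (j : Fin 3) :
    IsHomogeneousOfDegree a (d + 1) ((X j : MvPolynomial (Fin 3) k) • v) := by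
  intro i m hm
  rw [Pi.smul_apply, smul_eq_mul, coeff_X_mul'] at hm
  split_ifs at hm with hj
  · have h1 := hv i _ hm
    have h2 : m - Finsupp.single j 1 + Finsupp.single j 1 = m := by
      refine tsub_add_cancel_of_le ?_
      rw [Finsupp.single_le_iff]
      exact Nat.one_le_iff_ne_zero.2 (Finsupp.mem_support_iff.1 hj)
    rw [← h2, map_add, Finsupp.degree_single]
    omega
  · exact absurd rfl hm

theorem IsHomogeneousOfDegree.add {a : Fin n → ℕ} {d : ℕ} {v w : Fin n → MvPolynomial (Fin 3) k}
    (hv : IsHomogeneousOfDegree a d v) (hw : IsHomogeneousOfDegree a d w) :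
    IsHomogeneousOfDegree a d (v + w) :=
  (gradedPiece k a d).add_mem hv hw

theorem IsHomogeneousOfDegree.sub {a : Fin n → ℕ} {d : ℕ} {v w : Fin n → MvPolynomial (Fin 3) k}
    (hv : IsHomogeneousOfDegree a d v) (hw : IsHomogeneousOfDegree a d w) :
    IsHomogeneousOfDegree a d (v - w) :=
  (gradedPiece k a d).sub_mem hv hw

theorem isHomogeneousOfDegree_single (a : Fin n → ℕ) (j : Fin n) :
    IsHomogeneousOfDegree a (a j) (Pi.single j (1 : MvPolynomial (Fin 3) k)) := by
  intro i m hm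
  by_cases h : i = j
  · subst h
    rw [Pi.single_eq_same, coeff_one] at hm
    rw [← (show 0 = m by by_contra h; exact hm (if_neg h))]
    simp
  · rw [Pi.single_eq_of_ne h] at hm
    simp at hm

/-- Homogeneous elements of the image lift to homogeneous elements of the same degree. -/
theorem exists_homogeneous_lift {a : Fin n → ℕ} {b : Fin n' → ℕ}
    {δ : (Fin n → MvPolynomial (Fin 3) k) →ₗ[MvPolynomial (Fin 3) k]
      (Fin n' → MvPolynomial (Fin 3) k)}
    (hδ : ∀ d v, IsHomogeneousOfDegree a d v → IsHomogeneousOfDegree b d (δ v))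
    {d : ℕ} {v : Fin n → MvPolynomial (Fin 3) k} (hv : IsHomogeneousOfDegree b d (δ v)) :
    ∃ u, IsHomogeneousOfDegree a d u ∧ δ u = δ v := by
  refine ⟨pieceComponent a d v, pieceComponent_mem a d v, ?_⟩
  rw [← pieceComponent_map δ hδ, pieceComponent_of_mem hv, if_pos rfl]

/-- A minimal homogeneous map that does not kill a basis vector has a smaller shift in its
target. -/
theorem exists_shift_lt {a : Fin n → ℕ} {b : Fin n' → ℕ}
    {δ : (Fin n → MvPolynomial (Fin 3) k) →ₗ[MvPolynomial (Fin 3) k]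
      (Fin n' → MvPolynomial (Fin 3) k)}
    (hδ : ∀ d v, IsHomogeneousOfDegree a d v → IsHomogeneousOfDegree b d (δ v))
    (hmin : ∀ v i, constantCoeff (δ v i) = 0) (j : Fin n) (hj : δ (Pi.single j 1) ≠ 0) :
    ∃ i, b i < a j := by
  obtain ⟨i, hi⟩ := Function.ne_iff.1 hj
  obtain ⟨m, hm⟩ := ne_zero_iff.1 hi
  have h1 := hδ _ _ (isHomogeneousOfDegree_single a j) i m hm
  refine ⟨i, ?_⟩
  have h2 : m.degree ≠ 0 := by
    intro h0
    rw [Finsupp.degree_eq_zero_iff] at h0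
    subst h0
    exact hm (hmin _ i)
  omega

end Homogeneous

/-! ### Socle elements and the last module of the resolution -/

section Resolution

variable {k : Type*} [Field k] {I : Ideal (MvPolynomial (Fin 3) k)}

namespace MinimalFreeResolution

variable (F : MinimalFreeResolution I)

/-- The augmentation `d₁`, with target the free module of rank one. -/
noncomputable def augmentation : (Fin (F.rank 0) → MvPolynomial (Fin 3) k)
    →ₗ[MvPolynomial (Fin 3) k] (Fin 1 → MvPolynomial (Fin 3) k) :=
  LinearMap.pi fun _ => F.d₁

theorem augmentation_degree (d : ℕ) (v : Fin (F.rank 0) → MvPolynomial (Fin 3) k)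
    (hv : IsHomogeneousOfDegree (F.shift 0) d v) :
    IsHomogeneousOfDegree (fun _ : Fin 1 => 0) d (F.augmentation v) :=
  isHomogeneousOfDegree_const.2 (F.d₁_degree d v hv)

/-- Homogeneous elements of `I` are images of homogeneous elements. -/
theorem exists_lift_of_mem {f : MvPolynomial (Fin 3) k} (hf : f ∈ I) {d : ℕ}
    (hd : f.IsHomogeneous d) :
    ∃ u, IsHomogeneousOfDegree (F.shift 0) d u ∧ F.d₁ u = f := by
  rw [← F.range_d₁] at hf
  obtain ⟨v, rfl⟩ := hf
  obtain ⟨u, hu, h⟩ := exists_homogeneous_lift F.augmentation_degree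
    (isHomogeneousOfDegree_const.2 hd : IsHomogeneousOfDegree _ d (F.augmentation v))
  exact ⟨u, hu, congrFun h 0⟩

theorem d₁_mem (v : Fin (F.rank 0) → MvPolynomial (Fin 3) k) : F.d₁ v ∈ I :=
  F.range_d₁.le ⟨v, rfl⟩

theorem d₁_d₂ (v : Fin (F.rank 1) → MvPolynomial (Fin 3) k) : F.d₁ (F.d₂ v) = 0 :=
  (F.exact₁ _).2 ⟨v, rfl⟩

theorem d₂_d₃ (v : Fin (F.rank 2) → MvPolynomial (Fin 3) k) : F.d₂ (F.d₃ v) = 0 :=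
  (F.exact₂ _).2 ⟨v, rfl⟩

theorem d₂_single_ne_zero (j : Fin (F.rank 1)) : F.d₂ (Pi.single j 1) ≠ 0 := by
  intro h
  obtain ⟨v, hv⟩ := (F.exact₂ _).1 h
  have := F.minimal₃ v j
  rw [hv, Pi.single_eq_same, map_one] at this
  exact one_ne_zero this

theorem d₃_single_ne_zero (j : Fin (F.rank 2)) : F.d₃ (Pi.single j 1) ≠ 0 := by
  intro h
  have := F.injective_d₃ (h.trans (map_zero F.d₃).symm)
  exact one_ne_zero (Pi.single_eq_zero_iff.1 this)

theorem exists_shift_zero_lt (j : Fin (F.rank 1)) : ∃ i, F.shift 0 i < F.shift 1 j :=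
  exists_shift_lt F.d₂_degree F.minimal₂ j (F.d₂_single_ne_zero j)

theorem exists_shift_one_lt (j : Fin (F.rank 2)) : ∃ i, F.shift 1 i < F.shift 2 j :=
  exists_shift_lt F.d₃_degree F.minimal₃ j (F.d₃_single_ne_zero j)

/-- A nonzero socle element of degree `i` of `R/I` forces the shift `i + 3` in the last module of
the resolution. -/
theorem exists_shift_two_eq_of_socle {f : MvPolynomial (Fin 3) k} {i : ℕ}
    (hf : f.IsHomogeneous i) (hfI : f ∉ I) (hsoc : ∀ j, X j * f ∈ I) :
    ∃ l, F.shift 2 l = i + 3 := by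
  -- A hands-on comparison of Tor₃(A, k) in degree i+3 with the socle in degree i: lift the Koszul
  -- cycle of f through the resolution to w in F₃, then descend again if w is in (x₁, x₂, x₃)F₃.
  by_contra! hno
  have hX : ∀ j, (X j * f).IsHomogeneous (i + 1) := fun j => by
    rw [add_comm i 1]
    exact (isHomogeneous_X k j).mul hf
  choose u hu hu' using fun j => F.exists_lift_of_mem (hsoc j) (hX j)
  have hv : ∀ j l, ∃ v, IsHomogeneousOfDegree (F.shift 1) (i + 2) v ∧
      F.d₂ v = (X j : MvPolynomial (Fin 3) k) • u l - (X l : MvPolynomial (Fin 3) k) • u j := by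
    intro j l
    obtain ⟨v, hv⟩ := (F.exact₁ ((X j : MvPolynomial (Fin 3) k) • u l -
      (X l : MvPolynomial (Fin 3) k) • u j)).1 (by
        rw [map_sub, map_smul, map_smul, hu', hu', smul_eq_mul, smul_eq_mul]
        ring)
    rw [← hv]
    refine exists_homogeneous_lift F.d₂_degree ?_
    rw [hv]
    exact ((hu l).X_smul j).sub ((hu j).X_smul l)
  choose v hv hv' using hv
  have hz : F.d₂ ((X 0 : MvPolynomial (Fin 3) k) • v 1 2 - (X 1 : MvPolynomial (Fin 3) k) • v 0 2 +
      (X 2 : MvPolynomial (Fin 3) k) • v 0 1) = 0 := by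
    rw [map_add, map_sub, map_smul, map_smul, map_smul, hv', hv', hv']
    ext1 l
    simp only [Pi.add_apply, Pi.sub_apply, Pi.smul_apply, smul_eq_mul, Pi.zero_apply]
    ring
  obtain ⟨w', hw'⟩ := (F.exact₂ _).1 hz
  obtain ⟨w, hw, hww⟩ := exists_homogeneous_lift F.d₃_degree (d := i + 3) (v := w') (by
    rw [hw']
    exact (((hv 1 2).X_smul 0).sub ((hv 0 2).X_smul 1)).add ((hv 0 1).X_smul 2))
  rw [hw'] at hww
  -- A nonzero constant coordinate of w would sit at a shift equal to i+3.
  have hw0 : ∀ l, constantCoeff (w l) = 0 := by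
    intro l
    by_contra h
    have := hw l 0 h
    rw [map_zero, zero_add] at this
    exact hno l this
  choose w₀ w₁ w₂ hw₃ using fun l => exists_eq_sum_X_mul (hw0 l)
  have hw₄ : w = (X 0 : MvPolynomial (Fin 3) k) • w₀ + (X 1 : MvPolynomial (Fin 3) k) • w₁ +
      (X 2 : MvPolynomial (Fin 3) k) • w₂ := funext hw₃
  rw [hw₄, map_add, map_add, map_smul, map_smul, map_smul] at hww
  obtain ⟨t₀, t₁, t₂, h₀, h₁, h₂⟩ := koszul_syzygy_pi (a := v 1 2 - F.d₃ w₀)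
    (b := - v 0 2 - F.d₃ w₁) (c := v 0 1 - F.d₃ w₂) (by
      rw [← sub_eq_zero] at hww
      rw [← neg_eq_zero, ← hww]
      ext1 l
      simp only [Pi.add_apply, Pi.sub_apply, Pi.smul_apply, smul_eq_mul, Pi.neg_apply]
      ring)
  have h₁' := congrArg F.d₂ h₁
  have h₂' := congrArg F.d₂ h₂
  rw [map_sub, map_sub, map_smul, map_smul, d₂_d₃, sub_zero, map_neg, hv'] at h₁'
  rw [map_sub, map_sub, map_smul, map_smul, d₂_d₃, sub_zero, hv'] at h₂'
  -- After correction by boundaries the lifts of x_j f are proportional to the variables; the common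
  -- factor g satisfies d₁ g = f, contrary to f ∉ I.
  obtain ⟨g, hg⟩ := koszul_proportional_pi (y₀ := u 0 - F.d₂ t₀) (y₁ := u 1 - F.d₂ t₁)
    (y₂ := u 2 - F.d₂ t₂) (by
      rw [smul_sub, smul_sub, sub_eq_sub_iff_sub_eq_sub, h₂']) (by
      rw [smul_sub, smul_sub, sub_eq_sub_iff_sub_eq_sub, ← neg_inj, h₁', neg_sub])
  have hg' := congrArg F.d₁ hg
  rw [map_sub, d₁_d₂, sub_zero, hu', map_smul, smul_eq_mul] at hg'
  apply hfI
  rw [mul_left_cancel₀ (X_ne_zero (0 : Fin 3)) hg']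
  exact F.d₁_mem g

end MinimalFreeResolution

end Resolution

end GradedArtinian

namespace GradedArtinian

open MvPolynomial

/-! ### The h-vector, multiplicity and socle in degree zero -/

section HVector

variable {k : Type*} [Field k]

theorem homogeneousSubmodule_eq_restrictSupport (d : ℕ) :
    homogeneousSubmodule (Fin 3) k d = restrictSupport k {m : Fin 3 →₀ ℕ | m.degree + 0 = d} :=
  homogeneousSubmodule_eq_finsupp_supported (Fin 3) k d

instance (d : ℕ) : FiniteDimensional k (homogeneousSubmodule (Fin 3) k d) := by
  rw [homogeneousSubmodule_eq_restrictSupport]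
  infer_instance

theorem finrank_homogeneousSubmodule (d : ℕ) :
    (Module.finrank k (homogeneousSubmodule (Fin 3) k d) : ℤ) = formsDim d := by
  rw [homogeneousSubmodule_eq_restrictSupport,
    Module.finrank_eq_nat_card_basis (basisRestrictSupport k _)]
  have h := card_exponents_degree 0 d
  rw [Nat.cast_zero, sub_zero] at h
  exact h

variable (I : Ideal (MvPolynomial (Fin 3) k))

instance (d : ℕ) : FiniteDimensional k (component I d) := by
  rw [component]
  infer_instance

variable {I}

theorem mem_component {d : ℕ} {a : MvPolynomial (Fin 3) k ⧸ I} :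
    a ∈ component I d ↔ ∃ f : MvPolynomial (Fin 3) k, f.IsHomogeneous d ∧
      Ideal.Quotient.mk I f = a := Iff.rfl

theorem component_eq_bot {d : ℕ} (h : hVector I d = 0) : component I d = ⊥ :=
  Submodule.finrank_eq_zero.1 h

theorem mem_of_hVector_eq_zero {d : ℕ} (h : hVector I d = 0) {f : MvPolynomial (Fin 3) k}
    (hf : f.IsHomogeneous d) : f ∈ I := by
  have : Ideal.Quotient.mk I f ∈ component I d := ⟨f, hf, rfl⟩
  rw [component_eq_bot h, Submodule.mem_bot] at this
  exact Ideal.Quotient.eq_zero_iff_mem.1 this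

theorem hVector_add_finrank (I : Ideal (MvPolynomial (Fin 3) k)) (d : ℕ) :
    (hVector I d : ℤ) + (Module.finrank k
      (homogeneousSubmodule (Fin 3) k d ⊓ I.restrictScalars k : Submodule k _) : ℤ) =
      formsDim d := by
  have h := finrank_map_add_finrank_inf_ker (Ideal.Quotient.mkₐ k I).toLinearMap
    (homogeneousSubmodule (Fin 3) k d)
  have hker : LinearMap.ker (Ideal.Quotient.mkₐ k I).toLinearMap = I.restrictScalars k := by
    ext f
    exact Ideal.Quotient.eq_zero_iff_mem
  rw [hker] at h
  rw [← finrank_homogeneousSubmodule (k := k), ← h, hVector, component]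
  push_cast
  rfl

/-- The multiplicity is the sum of the entries of the `h`-vector. -/
theorem multiplicity_eq_sum (hI : ∀ f ∈ I, ∀ i : ℕ, homogeneousComponent i f ∈ I) (c : ℕ)
    (hc : ∀ i, c < i → hVector I i = 0) :
    multiplicity I = ∑ i ∈ Finset.range (c + 1), hVector I i := by
  let Θ : (∀ i : Fin (c + 1), component I i) →ₗ[k] MvPolynomial (Fin 3) k ⧸ I :=
    ∑ i : Fin (c + 1), (component I i).subtype ∘ₗ LinearMap.proj i
  have hΘ : ∀ w, Θ w = ∑ i, (w i : MvPolynomial (Fin 3) k ⧸ I) := by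
    intro w
    simp [Θ, LinearMap.sum_apply]
  have hinj : Function.Injective Θ := by
    rw [← LinearMap.ker_eq_bot, LinearMap.ker_eq_bot']
    intro w hw
    choose g hg hg' using fun i => mem_component.1 (w i).2
    rw [hΘ] at hw
    simp only [← hg'] at hw
    rw [← map_sum, Ideal.Quotient.eq_zero_iff_mem] at hw
    ext j
    rw [← hg' j]
    have h := hI _ hw j
    rw [map_sum, Finset.sum_eq_single j] at h
    · rw [homogeneousComponent_eq_self (hg j)] at h
      exact Ideal.Quotient.eq_zero_iff_mem.2 h
    · intro i _ hij
      rw [homogeneousComponent_of_mem (hg i), if_neg (fun h => hij (Fin.ext h).symm)]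
    · simp
  have hsurj : Function.Surjective Θ := by
    intro a
    obtain ⟨f, rfl⟩ := Ideal.Quotient.mk_surjective a
    refine ⟨fun i => ⟨Ideal.Quotient.mk I (homogeneousComponent i f),
      _, homogeneousComponent_isHomogeneous _ f, rfl⟩, ?_⟩
    rw [hΘ]
    change ∑ i : Fin (c + 1), Ideal.Quotient.mk I (homogeneousComponent (i : ℕ) f) = _
    rw [Fin.sum_univ_eq_sum_range (fun i => Ideal.Quotient.mk I (homogeneousComponent i f))]
    conv_rhs => rw [← sum_homogeneousComponent f]
    rw [map_sum]
    set D := c + 1 + (f.totalDegree + 1)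
    have hsub₁ : Finset.range (c + 1) ⊆ Finset.range D :=
      Finset.range_subset_range.2 (Nat.le_add_right _ _)
    have hsub₂ : Finset.range (f.totalDegree + 1) ⊆ Finset.range D :=
      Finset.range_subset_range.2 (Nat.le_add_left _ _)
    rw [Finset.sum_subset hsub₁, Finset.sum_subset hsub₂]
    · intro i _ hi
      rw [Finset.mem_range] at hi
      rw [homogeneousComponent_eq_zero i f (by omega), map_zero]
    · intro i _ hi
      rw [Finset.mem_range] at hi
      exact Ideal.Quotient.eq_zero_iff_mem.2
        (mem_of_hVector_eq_zero (hc i (by omega)) (homogeneousComponent_isHomogeneous i f))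
  rw [multiplicity, ← (LinearEquiv.ofBijective Θ ⟨hinj, hsurj⟩).finrank_eq,
    Module.finrank_pi_fintype, Fin.sum_univ_eq_sum_range (fun i => Module.finrank k (component I i))]
  rfl

/-- The unit is not a socle element of an algebra with nonzero linear forms. -/
theorem socleVector_zero (h : hVector I 1 ≠ 0) : socleVector I 0 = 0 := by
  rw [socleVector, Submodule.finrank_eq_zero, eq_bot_iff]
  rintro a ⟨ha, hs⟩
  obtain ⟨f, hf, rfl⟩ := mem_component.1 ha
  obtain ⟨t, rfl⟩ : ∃ t, f = C t :=
    ⟨coeff 0 f, by rw [← homogeneousComponent_zero, homogeneousComponent_eq_self hf]⟩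
  by_cases ht : t = 0
  · rw [ht, map_zero, map_zero]
    exact Submodule.zero_mem _
  · exfalso
    have hX : ∀ j : Fin 3, (X j : MvPolynomial (Fin 3) k) ∈ I := by
      intro j
      have h1 := hs j
      rw [← map_mul, Ideal.Quotient.eq_zero_iff_mem] at h1
      have h2 := I.mul_mem_left (C t⁻¹) h1
      rwa [← mul_assoc, ← map_mul, inv_mul_cancel₀ ht, map_one, one_mul] at h2
    apply h
    rw [hVector, Submodule.finrank_eq_zero, eq_bot_iff]
    intro a ha
    obtain ⟨g, hg, rfl⟩ := mem_component.1 ha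
    obtain ⟨p, q, r, hpqr⟩ := exists_eq_sum_X_mul (f := g) (by
      by_contra h0
      have := isHomogeneous_iff_degree.1 hg 0 h0
      simp at this)
    rw [Submodule.mem_bot, Ideal.Quotient.eq_zero_iff_mem, hpqr]
    exact I.add_mem (I.add_mem (I.mul_mem_right _ (hX 0)) (I.mul_mem_right _ (hX 1)))
      (I.mul_mem_right _ (hX 2))

end HVector

/-! ### Euler characteristic, Betti numbers and decay of the h-vector -/

namespace MinimalFreeResolution

variable {k : Type*} [Field k] {I : Ideal (MvPolynomial (Fin 3) k)}
  (F : MinimalFreeResolution I)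

/-- The alternating sum of the dimensions of the graded pieces of the resolution. -/
noncomputable def eulerCharacteristic (x : ℤ) : ℤ :=
  formsDim x - ∑ l, formsDim (x - F.shift 0 l) + ∑ l, formsDim (x - F.shift 1 l) -
    ∑ l, formsDim (x - F.shift 2 l)

theorem hVector_eq_eulerCharacteristic (d : ℕ) :
    (hVector I d : ℤ) = F.eulerCharacteristic d := by
  have e₁ := finrank_gradedPiece_of_exact F.d₂_degree F.exact₁ d
  have e₂ := finrank_gradedPiece_of_exact F.d₃_degree F.exact₂ d
  have e₃ := finrank_map_add_finrank_inf_ker (F.d₃.restrictScalars k)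
    (gradedPiece k (F.shift 2) d)
  have hker : LinearMap.ker (F.d₃.restrictScalars k) = ⊥ :=
    LinearMap.ker_eq_bot.2 F.injective_d₃
  rw [hker, inf_bot_eq, finrank_bot, add_zero] at e₃
  have hI : (gradedPiece k (F.shift 0) d).map (F.d₁.restrictScalars k) =
      homogeneousSubmodule (Fin 3) k d ⊓ I.restrictScalars k := by
    ext f
    constructor
    · rintro ⟨u, hu, rfl⟩
      exact ⟨F.d₁_degree d u hu, F.d₁_mem u⟩
    · rintro ⟨hf, hfI⟩
      exact F.exists_lift_of_mem hfI hf
  have e₀ := hVector_add_finrank I d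
  rw [← hI] at e₀
  have f₀ := finrank_gradedPiece (k := k) (F.shift 0) d
  have f₁ := finrank_gradedPiece (k := k) (F.shift 1) d
  have f₂ := finrank_gradedPiece (k := k) (F.shift 2) d
  rw [eulerCharacteristic, ← f₀, ← f₁, ← f₂]
  omega

/-- The number of summands `R(-x)` in a module of the resolution. -/
def betti (i : Fin 3) (x : ℤ) : ℤ := ∑ l, if x - F.shift i l = 0 then 1 else 0

theorem betti_nonneg (i : Fin 3) (x : ℤ) : 0 ≤ F.betti i x :=
  Finset.sum_nonneg fun l _ => by split_ifs <;> norm_num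

theorem betti_eq_zero {i : Fin 3} {x : ℤ} (h : ∀ l, (F.shift i l : ℤ) ≠ x) :
    F.betti i x = 0 :=
  Finset.sum_eq_zero fun l _ => if_neg fun h' => h l (by omega)

/-- The third difference of the Euler characteristic is the alternating sum of the graded Betti
numbers. -/
theorem eulerCharacteristic_third_difference (x : ℤ) (hx : x ≠ 0) :
    F.eulerCharacteristic x - 3 * F.eulerCharacteristic (x - 1) +
      3 * F.eulerCharacteristic (x - 2) - F.eulerCharacteristic (x - 3) =
      - F.betti 0 x + F.betti 1 x - F.betti 2 x := by
  have h : ∀ i, ∑ l, formsDim (x - F.shift i l) - 3 * ∑ l, formsDim (x - 1 - F.shift i l) +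
      3 * ∑ l, formsDim (x - 2 - F.shift i l) - ∑ l, formsDim (x - 3 - F.shift i l) =
      F.betti i x := by
    intro i
    rw [Finset.mul_sum, Finset.mul_sum, ← Finset.sum_sub_distrib, ← Finset.sum_add_distrib,
      ← Finset.sum_sub_distrib, betti]
    refine Finset.sum_congr rfl fun l _ => ?_
    rw [← formsDim_third_difference, sub_right_comm x 1, sub_right_comm x 2, sub_right_comm x 3]
  have h' := formsDim_third_difference x
  rw [if_neg hx] at h'
  simp only [eulerCharacteristic]
  linear_combination h' - h 0 + h 1 - h 2

theorem eulerCharacteristic_of_lt {x : ℤ} (h : ∀ i l, x < F.shift i l) :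
    F.eulerCharacteristic x = formsDim x := by
  have h0 : ∀ i, ∑ l, formsDim (x - F.shift i l) = 0 := fun i =>
    Finset.sum_eq_zero fun l _ => formsDim_of_neg (by have := h i l; omega)
  rw [eulerCharacteristic, h0, h0, h0]
  ring

/-- Below the last shifts of the resolution, the algebra has no socle. -/
theorem eq_zero_of_socle {i : ℕ} (h : ∀ l, F.shift 2 l ≠ i + 3)
    {a : MvPolynomial (Fin 3) k ⧸ I} (ha : a ∈ component I i)
    (hs : ∀ j, Ideal.Quotient.mk I (X j) * a = 0) : a = 0 := by
  obtain ⟨f, hf, rfl⟩ := mem_component.1 ha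
  by_contra h0
  obtain ⟨l, hl⟩ := F.exists_shift_two_eq_of_socle hf
    (fun h' => h0 (Ideal.Quotient.eq_zero_iff_mem.2 h'))
    (fun j => Ideal.Quotient.eq_zero_iff_mem.1 (by rw [map_mul]; exact hs j))
  exact h l hl

theorem X_mul_mem_component {i : ℕ} (j : Fin 3) {a : MvPolynomial (Fin 3) k ⧸ I}
    (ha : a ∈ component I i) : Ideal.Quotient.mk I (X j) * a ∈ component I (i + 1) := by
  obtain ⟨f, hf, rfl⟩ := mem_component.1 ha
  rw [← map_mul, add_comm]
  exact mem_component.2 ⟨_, (isHomogeneous_X k j).mul hf, rfl⟩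

/-- There is no socle in degrees below p, so a nonzero element can be multiplied by variables and
stay nonzero until degree p is reached. -/
theorem eq_zero_of_forall_monomial_mul {p : ℕ} (hp : ∀ l, p + 3 ≤ F.shift 2 l) (t : ℕ) :
    ∀ i, i + t ≤ p → ∀ a ∈ component I i,
      (∀ μ ∈ exponents t, (∏ j, Ideal.Quotient.mk I (X j) ^ μ j) * a = 0) → a = 0 := by
  induction t with
  | zero =>
    intro i _ a _ h
    simpa using h 0 (mem_exponents.2 (by simp))
  | succ t ih =>
    intro i hi a ha h
    refine F.eq_zero_of_socle (i := i) (fun l => by have := hp l; omega) ha fun j => ?_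
    refine ih (i + 1) (by omega) _ (X_mul_mem_component j ha) fun μ hμ => ?_
    have := h (μ + Pi.single j 1) (by
      rw [mem_exponents] at hμ ⊢
      simp [Finset.sum_add_distrib, hμ])
    rwa [monomial_add_single, mul_assoc] at this

/-- The bound on the growth of the `h`-vector below the smallest last shift. -/
theorem hVector_decay {p : ℕ} (hp : ∀ l, p + 3 ≤ F.shift 2 l) (i t : ℕ) (h : i + t + 1 = p) :
    (t + 1) * hVector I i ≤ (t + 3) * hVector I (i + 1) :=
  finrank_decay (fun j => Ideal.Quotient.mk I (X j))
    (fun j _ ha => X_mul_mem_component j ha) t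
    (F.eq_zero_of_forall_monomial_mul hp (t + 1) i (by omega))

/-- The top degree of the algebra gives a last shift. -/
theorem exists_shift_two_eq {c : ℕ} (h : hVector I c ≠ 0) (h' : hVector I (c + 1) = 0) :
    ∃ l, F.shift 2 l = c + 3 := by
  by_contra! hno
  apply h
  rw [hVector, Submodule.finrank_eq_zero, eq_bot_iff]
  intro a ha
  refine F.eq_zero_of_socle (fun l => hno l) ha fun j => ?_
  have := X_mul_mem_component j ha
  rwa [component_eq_bot h', Submodule.mem_bot] at this

end MinimalFreeResolution

end GradedArtinian

namespace GradedArtinian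

/-! ### Numerical consequences of decay and of compressedness -/

section Numerics

/-- Descending induction on j: the tail from j+1 contributes (t+3)h_{j+1} ≥ (t+1)h_j, and the new
term adds 3h_j, giving t+4. -/
theorem le_three_mul_sum_of_decay {h : ℕ → ℕ} {p : ℕ}
    (hd : ∀ i t, i + t + 1 = p → (t + 1) * h i ≤ (t + 3) * h (i + 1)) (t : ℕ) :
    ∀ j, j + t = p → (t + 3) * h j ≤ 3 * ∑ i ∈ Finset.Ico j (p + 1), h i := by
  induction t with
  | zero =>
    intro j hj
    rw [Finset.sum_eq_sum_Ico_succ_bot (by omega)]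
    omega
  | succ t ih =>
    intro j hj
    have h1 := ih (j + 1) (by omega)
    have h2 := hd j t (by omega)
    rw [Finset.sum_eq_sum_Ico_succ_bot (by omega)]
    linarith

theorem six_mul_sum_formsDim (b : ℕ) :
    6 * ∑ i ∈ Finset.range b, formsDim i = (b : ℤ) * (b + 1) * (b + 2) := by
  induction b with
  | zero => simp
  | succ b ih =>
    have h := two_mul_formsDim (x := b) (by omega)
    rw [Finset.sum_range_succ, mul_add, ih]
    push_cast
    linear_combination 3 * h

theorem six_mul_sum_Ico_formsDim (n : ℕ) : ∀ b : ℕ,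
    6 * ∑ i ∈ Finset.Ico b (b + n + 1), formsDim ((b + n : ℕ) - i) =
      ((n : ℤ) + 1) * (n + 2) * (n + 3) := by
  induction n with
  | zero =>
    intro b
    have h := two_mul_formsDim (x := 0) (by omega)
    simp
    linarith
  | succ n ih =>
    intro b
    have h := two_mul_formsDim (x := (n : ℤ) + 1) (by omega)
    have ih' := ih (b + 1)
    rw [show b + 1 + n = b + (n + 1) by omega] at ih'
    rw [Finset.sum_eq_sum_Ico_succ_bot (by omega), mul_add, ih',
      show ((b + (n + 1) : ℕ) : ℤ) - b = (n : ℤ) + 1 by push_cast; ring]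
    push_cast
    linear_combination 3 * h

/-- The sum of the dimensions of the inverse system of a form of degree `j`, from degree `b` on. -/
theorem six_mul_sum_formsDim_sub {b j c : ℕ} (hbj : b ≤ j) (hjc : j ≤ c) :
    6 * ∑ i ∈ Finset.Ico b (c + 1), formsDim ((j : ℤ) - i) =
      ((j : ℤ) - b + 1) * (j - b + 2) * (j - b + 3) := by
  obtain ⟨n, rfl⟩ := Nat.exists_eq_add_of_le hbj
  have h := six_mul_sum_Ico_formsDim n b
  have hsub : Finset.Ico b (b + n + 1) ⊆ Finset.Ico b (c + 1) :=
    Finset.Ico_subset_Ico_right (by omega)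
  rw [← Finset.sum_subset hsub, h]
  · push_cast
    ring
  · intro i hi hi'
    rw [Finset.mem_Ico] at hi hi'
    exact formsDim_of_neg (by omega)

/-- The numerical data of the `h`-vector `h` of a compressed algebra of codimension three, with
socle degree `c`, socle-vector `s`, and order index `b`. -/
structure CompressedVector (h : ℕ → ℕ) (b c : ℕ) (s : ℕ → ℕ) : Prop where
  one_le : 1 ≤ b
  le : b ≤ c
  pos : h c ≠ 0
  eq_zero : ∀ i, c < i → h i = 0
  of_lt : ∀ i, i < b → (h i : ℤ) = formsDim i
  of_le : ∀ i, b ≤ i → (h i : ℤ) = ∑ j ∈ Finset.Icc b c, formsDim ((j : ℤ) - i) * (s j : ℤ)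
  lt_sum : formsDim ((b : ℤ) - 1) < ∑ j ∈ Finset.Icc b c, formsDim ((j : ℤ) - b + 1) * (s j : ℤ)
  sum_le : (h b : ℤ) ≤ formsDim b

namespace CompressedVector

variable {h : ℕ → ℕ} {b c : ℕ} {s : ℕ → ℕ}

theorem six_mul_sum (H : CompressedVector h b c s) :
    6 * ∑ i ∈ Finset.range (c + 1), (h i : ℤ) = (b : ℤ) * (b + 1) * (b + 2) +
      ∑ j ∈ Finset.Icc b c, ((j : ℤ) - b + 1) * (j - b + 2) * (j - b + 3) * (s j : ℤ) := by
  have hbc := H.le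
  rw [← Finset.sum_range_add_sum_Ico _ (show b ≤ c + 1 by omega), mul_add,
    ← six_mul_sum_formsDim]
  congr 1
  · rw [Finset.sum_congr rfl fun i hi => H.of_lt i (Finset.mem_range.1 hi)]
  · rw [Finset.sum_congr rfl fun i hi => H.of_le i (Finset.mem_Ico.1 hi).1, Finset.sum_comm,
      Finset.mul_sum]
    refine Finset.sum_congr rfl fun j hj => ?_
    rw [Finset.mem_Icc] at hj
    rw [← Finset.sum_mul, ← mul_assoc, six_mul_sum_formsDim_sub hj.1 hj.2]

/-- The three terms of index at least b combine to ∑ s_j N(j-b+1), because the third difference of N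
vanishes at j-b+1 > 0; what remains is -r_{b-1}. -/
theorem third_difference_pos (H : CompressedVector h b c s) :
    0 < (h (b + 2) : ℤ) - 3 * h (b + 1) + 3 * h b - h (b - 1) := by
  have h1 := H.one_le
  have h2 := H.lt_sum
  rw [H.of_le (b + 2) (by omega), H.of_le (b + 1) (by omega), H.of_le b le_rfl,
    H.of_lt (b - 1) (by omega), Nat.cast_sub h1, Finset.mul_sum, Finset.mul_sum,
    ← Finset.sum_sub_distrib, ← Finset.sum_add_distrib]
  push_cast
  rw [sub_pos]
  refine h2.trans_le (le_of_eq (Finset.sum_congr rfl fun j hj => ?_))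
  rw [Finset.mem_Icc] at hj
  have e := formsDim_third_difference ((j : ℤ) - b + 1)
  rw [if_neg (by omega), show (j : ℤ) - b + 1 - 1 = j - b by ring,
    show (j : ℤ) - b + 1 - 2 = j - (b + 1) by ring,
    show (j : ℤ) - b + 1 - 3 = j - (b + 2) by ring] at e
  linear_combination (s j : ℤ) * e

/-- The first upper bound for the multiplicity. -/
theorem six_mul_sum_le (H : CompressedVector h b c s) :
    6 * ∑ i ∈ Finset.range (c + 1), (h i : ℤ) ≤ ((b : ℤ) + 1) * (b + 2) * (c + 3) := by
  have e1 := H.sum_le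
  rw [H.of_le b le_rfl] at e1
  have e2 := two_mul_formsDim (x := b) (by omega)
  -- Bound the factor j-b+3 by c-b+3; the other two factors sum to 2h_b.
  have e3 : ∑ j ∈ Finset.Icc b c, ((j : ℤ) - b + 1) * (j - b + 2) * (j - b + 3) * (s j : ℤ) ≤
      ∑ j ∈ Finset.Icc b c, ((c : ℤ) - b + 3) * (2 * (formsDim ((j : ℤ) - b) * (s j : ℤ))) := by
    refine Finset.sum_le_sum fun j hj => ?_
    rw [Finset.mem_Icc] at hj
    have e := two_mul_formsDim (x := (j : ℤ) - b) (by omega)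
    have hn : 0 ≤ 2 * (formsDim ((j : ℤ) - b) * (s j : ℤ)) :=
      mul_nonneg (by norm_num) (mul_nonneg (formsDim_nonneg _) (by positivity))
    calc ((j : ℤ) - b + 1) * (j - b + 2) * (j - b + 3) * (s j : ℤ)
        = (j - b + 3) * (2 * (formsDim ((j : ℤ) - b) * (s j : ℤ))) := by
          linear_combination -(((j : ℤ) - b + 3) * (s j : ℤ)) * e
      _ ≤ _ := mul_le_mul_of_nonneg_right (by omega) hn
  rw [← Finset.mul_sum, ← Finset.mul_sum] at e3
  have hbc := H.le
  have e4 := mul_le_mul_of_nonneg_left e1 (show (0 : ℤ) ≤ c - b + 3 by omega)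
  rw [H.six_mul_sum]
  have e5 : ((c : ℤ) - b + 3) * (2 * formsDim b) = (c - b + 3) * ((b + 1) * (b + 2)) := by rw [e2]
  linarith

/-- The second upper bound for the multiplicity. -/
theorem six_mul_sum_le_of_le (H : CompressedVector h b c s)
    (hle : 3 * (h b : ℤ) - h (b + 1) ≤ b * (b + 2)) :
    6 * ∑ i ∈ Finset.range (c + 1), (h i : ℤ) ≤ (b : ℤ) * (b + 2) * (c + 3) := by
  -- From 3N(n) - N(n-1) = (n+1)(n+3) with n = j-b; the middle factor j-b+2 is then the one bounded
  -- by its maximum.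
  have e1 : ∑ j ∈ Finset.Icc b c, ((j : ℤ) - b + 1) * (j - b + 3) * (s j : ℤ) =
      3 * h b - h (b + 1) := by
    rw [H.of_le b le_rfl, H.of_le (b + 1) (by omega), Finset.mul_sum, ← Finset.sum_sub_distrib]
    refine Finset.sum_congr rfl fun j hj => ?_
    rw [Finset.mem_Icc] at hj
    have e := two_mul_formsDim (x := (j : ℤ) - b) (by omega)
    have e' := two_mul_formsDim (x := (j : ℤ) - (b + 1 : ℕ)) (by push_cast; omega)
    push_cast at e' ⊢
    refine mul_left_cancel₀ (two_ne_zero (α := ℤ)) ?_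
    linear_combination (s j : ℤ) * e' - 3 * (s j : ℤ) * e
  have e3 : ∑ j ∈ Finset.Icc b c, ((j : ℤ) - b + 1) * (j - b + 2) * (j - b + 3) * (s j : ℤ) ≤
      ∑ j ∈ Finset.Icc b c, ((c : ℤ) - b + 2) * (((j : ℤ) - b + 1) * (j - b + 3) * (s j : ℤ)) := by
    refine Finset.sum_le_sum fun j hj => ?_
    rw [Finset.mem_Icc] at hj
    have hn : 0 ≤ ((j : ℤ) - b + 1) * (j - b + 3) * (s j : ℤ) :=
      mul_nonneg (mul_nonneg (by omega) (by omega)) (by positivity)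
    calc ((j : ℤ) - b + 1) * (j - b + 2) * (j - b + 3) * (s j : ℤ)
        = (j - b + 2) * (((j : ℤ) - b + 1) * (j - b + 3) * (s j : ℤ)) := by ring
      _ ≤ _ := mul_le_mul_of_nonneg_right (by omega) hn
  rw [← Finset.mul_sum, e1] at e3
  have hbc := H.le
  have e4 := mul_le_mul_of_nonneg_left hle (show (0 : ℤ) ≤ c - b + 2 by omega)
  rw [H.six_mul_sum]
  linarith

end CompressedVector

end Numerics

/-- The `h`-vector of a compressed algebra of codimension three. -/
theorem IsCompressed.exists_compressedVector {k : Type*} [Field k]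
    {J : Ideal (MvPolynomial (Fin 3) k)} (hJ : IsCompressed J) :
    ∃ b c s, CompressedVector (hVector J) b c s := by
  obtain ⟨c, b, hc, hb, hbc, hr, hr', hs, hh⟩ := hJ.exists_index
  set s := socleVector J with hs_def
  -- Compressedness only speaks of s_1, …, s_{b-1}; the vanishing of s_0 comes from h_1 = 3.
  have hs0 : s 0 = 0 := socleVector_zero (by rw [hJ.algebra.codim]; norm_num)
  have hsb : ∀ i, i < b → s i = 0 := by
    intro i hi
    rcases Nat.eq_zero_or_pos i with rfl | h
    · exact hs0
    · exact hs i h hi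
  have hdef : ∀ d, socleDefect 3 c s d =
      formsDim d - ∑ j ∈ Finset.Icc b c, formsDim ((j : ℤ) - d) * (s j : ℤ) := by
    intro d
    rw [socleDefect, fullDim_three]
    congr 1
    have e : ∀ j ∈ Finset.Icc d c, (fullDim 3 (j - d) : ℤ) * (s j : ℤ) =
        formsDim ((j : ℤ) - d) * (s j : ℤ) := by
      intro j hj
      rw [fullDim_three, Nat.cast_sub (Finset.mem_Icc.1 hj).1]
    rw [Finset.sum_congr rfl e]
    have h1 : ∑ j ∈ Finset.Icc d c, formsDim ((j : ℤ) - d) * (s j : ℤ) =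
        ∑ j ∈ Finset.range (c + 1), formsDim ((j : ℤ) - d) * (s j : ℤ) := by
      refine Finset.sum_subset (fun j hj => ?_) fun j hj hj' => ?_
      · rw [Finset.mem_Icc] at hj
        rw [Finset.mem_range]
        omega
      · rw [Finset.mem_range] at hj
        rw [Finset.mem_Icc] at hj'
        rw [formsDim_of_neg (by omega), zero_mul]
    have h2 : ∑ j ∈ Finset.Icc b c, formsDim ((j : ℤ) - d) * (s j : ℤ) =
        ∑ j ∈ Finset.range (c + 1), formsDim ((j : ℤ) - d) * (s j : ℤ) := by
      refine Finset.sum_subset (fun j hj => ?_) fun j hj hj' => ?_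
      · rw [Finset.mem_Icc] at hj
        rw [Finset.mem_range]
        omega
      · rw [Finset.mem_range] at hj
        rw [Finset.mem_Icc] at hj'
        rw [hsb j (by omega), Nat.cast_zero, mul_zero]
    rw [h1, h2]
  have hmono : ∀ x y : ℤ, x ≤ y → ∑ j ∈ Finset.Icc b c, formsDim ((j : ℤ) - y) * (s j : ℤ) ≤
      ∑ j ∈ Finset.Icc b c, formsDim ((j : ℤ) - x) * (s j : ℤ) := fun x y hxy =>
    Finset.sum_le_sum fun j _ =>
      mul_le_mul_of_nonneg_right (formsDim_mono (by omega)) (by positivity)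
  have hzero : ∀ i, c < i → hVector J i = 0 := by
    intro i hi
    by_contra h
    have : i ≤ c := hc.2 (Nat.pos_of_ne_zero h)
    omega
  rw [hdef, sub_nonneg] at hr
  rw [hdef, Nat.cast_sub hb, sub_neg] at hr'
  have hof_le : ∀ i, b ≤ i →
      (hVector J i : ℤ) = ∑ j ∈ Finset.Icc b c, formsDim ((j : ℤ) - i) * (s j : ℤ) := by
    intro i hi
    by_cases hic : i ≤ c
    · rw [hh i hic, hdef, fullDim_three, sub_sub_cancel, min_eq_left]
      -- As i grows, N(i) increases and the socle sum decreases, so r_b ≥ 0 propagates to r_i ≥ 0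
      -- for i ≥ b.
      have h1 := hmono b i (by omega)
      have h2 : formsDim b ≤ formsDim i := formsDim_mono (by omega)
      linarith
    · rw [hzero i (by omega), Finset.sum_eq_zero, Nat.cast_zero]
      intro j hj
      rw [Finset.mem_Icc] at hj
      rw [formsDim_of_neg (by omega), zero_mul]
  refine ⟨b, c, s, hb, hbc, (Nat.pos_iff_ne_zero.1 hc.1), hzero, ?_, hof_le, ?_, ?_⟩
  · intro i hi
    rw [hh i (by omega), hdef, fullDim_three, sub_sub_cancel, min_eq_right]
    -- By the same monotonicity r_{b-1} < 0 propagates downwards.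
    have h1 := hmono i ((b : ℤ) - 1) (by omega)
    have h2 : formsDim i ≤ formsDim ((b : ℤ) - 1) := formsDim_mono (by omega)
    push_cast at hr'
    linarith
  · push_cast at hr'
    refine hr'.trans_le (le_of_eq (Finset.sum_congr rfl fun j _ => ?_))
    rw [sub_sub_eq_add_sub, add_sub_right_comm]
  · rw [hof_le b le_rfl]
    exact hr

namespace MinimalFreeResolution

variable {k : Type*} [Field k] {I : Ideal (MvPolynomial (Fin 3) k)}
  (F : MinimalFreeResolution I)

/-- The least shift of the first module is the initial degree of the ideal. -/
theorem hVector_lt_of_least {a : ℕ} (ha : IsLeast (Set.range (F.shift 0)) a)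
    (h1 : ∀ l, a + 1 ≤ F.shift 1 l) (h2 : ∀ l, a + 1 ≤ F.shift 2 l) :
    (hVector I a : ℤ) < formsDim a := by
  obtain ⟨l, hl⟩ := ha.1
  have e : ∀ i, (∀ l, a + 1 ≤ F.shift i l) → ∑ l, formsDim ((a : ℤ) - F.shift i l) = 0 :=
    fun i h => Finset.sum_eq_zero fun l _ => formsDim_of_neg (by have := h l; omega)
  rw [F.hVector_eq_eulerCharacteristic, eulerCharacteristic, e 1 h1, e 2 h2]
  have hpos : 0 < ∑ l, formsDim ((a : ℤ) - F.shift 0 l) := by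
    refine Finset.sum_pos' (fun l _ => formsDim_nonneg _) ⟨l, Finset.mem_univ l, ?_⟩
    rw [hl, sub_self]
    decide
  linarith

end MinimalFreeResolution

end GradedArtinian

namespace GradedArtinian

/-! ### The lower bound -/

namespace MinimalFreeResolution

variable {k : Type*} [Field k] {I : Ideal (MvPolynomial (Fin 3) k)}
  (F : MinimalFreeResolution I)

theorem eulerCharacteristic_of_lt_least {m : Fin 3 → ℕ} (hm : ∀ i l, m i ≤ F.shift i l)
    (h01 : m 0 < m 1) (h12 : m 1 < m 2) {x : ℤ} (hx : x < m 0) :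
    F.eulerCharacteristic x = formsDim x := by
  refine F.eulerCharacteristic_of_lt fun i l => ?_
  have := hm i l
  fin_cases i
  · simp only [Fin.zero_eta] at this ⊢; omega
  · simp only [Fin.mk_one] at this ⊢; omega
  · simp only [Fin.reduceFinMk] at this ⊢; omega

/-- The lower bound for the multiplicity when the least shift of the second module exceeds the
initial degree by at most two. -/
theorem mul_le_six_mul_sum {m : Fin 3 → ℕ} (hm : ∀ i, IsLeast (Set.range (F.shift i)) (m i))
    (h0 : 1 ≤ m 0) (h01 : m 0 < m 1) (h12 : m 1 < m 2) (h1 : m 1 ≤ m 0 + 2) {c : ℕ}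
    (hc : ∀ i, c < i → hVector I i = 0) :
    (m 0 * m 1 * m 2 : ℤ) ≤ 6 * ∑ i ∈ Finset.range (c + 1), (hVector I i : ℤ) := by
  have hmle : ∀ i l, m i ≤ F.shift i l := fun i l => (hm i).2 ⟨l, rfl⟩
  have hlt : ∀ x : ℤ, x < m 0 → F.eulerCharacteristic x = formsDim x := fun x hx =>
    F.eulerCharacteristic_of_lt_least hmle h01 h12 hx
  obtain ⟨p, hp⟩ := Nat.exists_eq_add_of_le (show 3 ≤ m 2 by omega)
  have hdecay := F.hVector_decay (p := p) fun l => by have := hmle 2 l; omega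
  have hsum := le_three_mul_sum_of_decay hdecay
  have hinit : ∀ a ≤ m 0, 6 * ∑ i ∈ Finset.range a, (hVector I i : ℤ) =
      (a : ℤ) * (a + 1) * (a + 2) := by
    intro a ha
    rw [← six_mul_sum_formsDim]
    congr 1
    refine Finset.sum_congr rfl fun i hi => ?_
    rw [Finset.mem_range] at hi
    rw [F.hVector_eq_eulerCharacteristic, hlt _ (by omega)]
  have htotal : ∀ a ≤ p + 1, ∑ i ∈ Finset.range a, (hVector I i : ℤ) +
      ∑ i ∈ Finset.Ico a (p + 1), (hVector I i : ℤ) ≤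
      ∑ i ∈ Finset.range (c + 1), (hVector I i : ℤ) := by
    intro a ha
    rw [Finset.sum_range_add_sum_Ico _ ha]
    have h := Finset.sum_subset (f := fun i => (hVector I i : ℤ)) (Finset.range_subset_range.2
      (show c + 1 ≤ p + 1 + (c + 1) by omega)) fun i _ hi => by
        rw [Finset.mem_range] at hi
        rw [hc i (by omega), Nat.cast_zero]
    rw [h]
    exact Finset.sum_le_sum_of_subset_of_nonneg (Finset.range_subset_range.2 (by omega))
      fun i _ _ => by positivity
  have hm2 : (m 2 : ℤ) = 3 + p := by exact_mod_cast hp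
  obtain ⟨a, ha⟩ : ∃ a, m 0 = a + 1 := ⟨m 0 - 1, by omega⟩
  rcases Nat.lt_or_ge (m 1) (m 0 + 2) with h1' | h1'
  -- Telescope from a = m₁-1, the last degree where h is known to be full: 6e ≥ a(a+1)(a+2) +
  -- 2(t+3)N(a) = (a+1)(a+2)(p+3).
  · have hm1 : (m 1 : ℤ) = a + 2 := by omega
    obtain ⟨t, ht⟩ := Nat.exists_eq_add_of_le (show a ≤ p by omega)
    have e1 : ((t : ℤ) + 3) * hVector I a ≤
        3 * ∑ i ∈ Finset.Ico a (p + 1), (hVector I i : ℤ) := by exact_mod_cast hsum t a ht.symm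
    have e2 := htotal a (by omega)
    have e3 := hinit a (by omega)
    have e4 : (hVector I a : ℤ) = formsDim a := by
      rw [F.hVector_eq_eulerCharacteristic, hlt _ (by omega)]
    have e5 := two_mul_formsDim (x := a) (by omega)
    rw [e4] at e1
    have e6 : ((t : ℤ) + 3) * (2 * formsDim a) = (t + 3) * ((a + 1) * (a + 2)) := by rw [e5]
    have hpt : (p : ℤ) = a + t := by exact_mod_cast ht
    rw [hm1, hm2, ha, hpt]
    push_cast
    linarith
  · have hm1 : m 1 = m 0 + 2 := by omega
    obtain ⟨t, ht⟩ := Nat.exists_eq_add_of_le (show m 0 ≤ p by omega)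
    have e1 : ((t : ℤ) + 3) * hVector I (m 0) ≤
        3 * ∑ i ∈ Finset.Ico (m 0) (p + 1), (hVector I i : ℤ) := by
      exact_mod_cast hsum t (m 0) ht.symm
    have e2 := htotal (m 0) (by omega)
    have e3 := hinit (m 0) le_rfl
    have e4 : (t : ℤ) * hVector I (m 0) ≤ (t + 2) * hVector I (m 0 + 1) := by
      rcases t with _ | t
      · push_cast
        rw [zero_mul]
        positivity
      · have := hdecay (m 0) t (by omega)
        push_cast
        have h : ((t : ℤ) + 1) * hVector I (m 0) ≤ (t + 3) * hVector I (m 0 + 1) := by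
          exact_mod_cast this
        linarith
    -- Third difference at m₁+1, where F₂ has no shift: it is at most 0, and 3N(m₁-1) - N(m₁-2) =
    -- m₁(m₁+2). Combined with `e4` this bounds 2(t+3)h_{m₁} below by (t+2)m₁(m₁+2).
    have e5 : (m 0 : ℤ) * (m 0 + 2) ≤ 3 * hVector I (m 0) - hVector I (m 0 + 1) := by
      have d := F.eulerCharacteristic_third_difference ((m 0 + 1 : ℕ) : ℤ) (by omega)
      rw [F.betti_eq_zero (i := 1) fun l => by have := hmle 1 l; omega] at d
      have n0 := F.betti_nonneg 0 ((m 0 + 1 : ℕ) : ℤ)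
      have n2 := F.betti_nonneg 2 ((m 0 + 1 : ℕ) : ℤ)
      rw [hlt (((m 0 + 1 : ℕ) : ℤ) - 2) (by omega), hlt (((m 0 + 1 : ℕ) : ℤ) - 3) (by omega),
        show ((m 0 + 1 : ℕ) : ℤ) - 1 = (m 0 : ℕ) by push_cast; ring,
        ← F.hVector_eq_eulerCharacteristic, ← F.hVector_eq_eulerCharacteristic] at d
      have f2 := two_mul_formsDim (x := ((m 0 + 1 : ℕ) : ℤ) - 2) (by omega)
      have f3 := two_mul_formsDim (x := ((m 0 + 1 : ℕ) : ℤ) - 3) (by omega)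
      push_cast at d f2 f3 n0 n2 ⊢
      linarith
    have e6 := mul_le_mul_of_nonneg_left e5 (show (0 : ℤ) ≤ t + 2 by positivity)
    have hpt : (p : ℤ) = m 0 + t := by exact_mod_cast ht
    rw [hm1, hm2, hpt]
    push_cast
    linarith

end MinimalFreeResolution

end GradedArtinian

/-! ### Assembly of the two bounds -/

theorem theorem2p7 {k : Type*} [Field k] [CharZero k]
    (I : Ideal (MvPolynomial (Fin 3) k)) (hI : GradedArtinian.IsArtinianAlgebra I)
    (hcompressed : ∃ J : Ideal (MvPolynomial (Fin 3) k), GradedArtinian.IsCompressed J ∧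
      ∀ i, GradedArtinian.hVector I i = GradedArtinian.hVector J i)
    (F : GradedArtinian.MinimalFreeResolution I) :
    ∃ m M : Fin 3 → ℕ,
      (∀ i, IsLeast (Set.range (F.shift i)) (m i)) ∧
      (∀ i, IsGreatest (Set.range (F.shift i)) (M i)) ∧
      (m 0 * m 1 * m 2 : ℚ) / 6 ≤ (GradedArtinian.multiplicity I : ℚ) ∧
      (GradedArtinian.multiplicity I : ℚ) ≤ (M 0 * M 1 * M 2 : ℚ) / 6 := by
  obtain ⟨J, hJ, hIJ⟩ := hcompressed
  obtain ⟨b, c, s, H⟩ := hJ.exists_compressedVector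
  rw [← funext hIJ] at H
  have hb := H.one_le
  obtain ⟨l₂, hl₂⟩ := F.exists_shift_two_eq H.pos (H.eq_zero (c + 1) (by omega))
  obtain ⟨l₁, -⟩ := F.exists_shift_one_lt l₂
  obtain ⟨l₀, -⟩ := F.exists_shift_zero_lt l₁
  have hne : ∀ i, Nonempty (Fin (F.rank i)) := by
    intro i
    fin_cases i
    exacts [⟨l₀⟩, ⟨l₁⟩, ⟨l₂⟩]
  choose x hx using fun i => Finite.exists_min (F.shift i)
  choose y hy using fun i => Finite.exists_max (F.shift i)
  have hm : ∀ i, IsLeast (Set.range (F.shift i)) (F.shift i (x i)) := fun i =>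
    ⟨⟨x i, rfl⟩, by rintro _ ⟨l, rfl⟩; exact hx i l⟩
  have hM : ∀ i, IsGreatest (Set.range (F.shift i)) (F.shift i (y i)) := fun i =>
    ⟨⟨y i, rfl⟩, by rintro _ ⟨l, rfl⟩; exact hy i l⟩
  refine ⟨_, _, hm, hM, ?_⟩
  set m : Fin 3 → ℕ := fun i => F.shift i (x i)
  set M : Fin 3 → ℕ := fun i => F.shift i (y i)
  have hmle : ∀ i l, m i ≤ F.shift i l := hx
  have hleM : ∀ i l, F.shift i l ≤ M i := hy
  have h01 : m 0 < m 1 := by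
    obtain ⟨l, hl⟩ := F.exists_shift_zero_lt (x 1)
    exact (hmle 0 l).trans_lt hl
  have h12 : m 1 < m 2 := by
    obtain ⟨l, hl⟩ := F.exists_shift_one_lt (x 2)
    exact (hmle 1 l).trans_lt hl
  have hbm : b ≤ m 0 := by
    by_contra hlt
    have h := F.hVector_lt_of_least (hm 0) (fun l => h01.trans_le (hmle 1 l))
      (fun l => (h01.trans h12).trans_le (hmle 2 l))
    exact h.ne (H.of_lt (m 0) (not_le.1 hlt))
  -- Only the second module contributes positively to the third difference, which is positive at
  -- b+2.
  have hb2 : ∃ l, F.shift 1 l = b + 2 := by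
    by_contra! hno
    have h := H.third_difference_pos
    have d := F.eulerCharacteristic_third_difference ((b + 2 : ℕ) : ℤ) (by omega)
    rw [F.betti_eq_zero (i := 1) fun l => by exact_mod_cast hno l,
      show ((b + 2 : ℕ) : ℤ) - 1 = (b + 1 : ℕ) by push_cast; ring,
      show ((b + 2 : ℕ) : ℤ) - 2 = (b : ℕ) by push_cast; ring,
      show ((b + 2 : ℕ) : ℤ) - 3 = (b - 1 : ℕ) by push_cast [hb]; ring] at d
    simp only [← F.hVector_eq_eulerCharacteristic] at d
    have n0 := F.betti_nonneg 0 ((b + 2 : ℕ) : ℤ)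
    have n2 := F.betti_nonneg 2 ((b + 2 : ℕ) : ℤ)
    linarith
  obtain ⟨l, hl⟩ := hb2
  have hm1 := hmle 1 l
  have hM1 := hleM 1 l
  have hM2 := hleM 2 l₂
  have hM0 : m 0 ≤ M 0 := hleM 0 (x 0)
  have he : (6 * GradedArtinian.multiplicity I : ℤ) =
      6 * ∑ i ∈ Finset.range (c + 1), (GradedArtinian.hVector I i : ℤ) := by
    rw [GradedArtinian.multiplicity_eq_sum hI.homogeneous c H.eq_zero]
    push_cast
    rfl
  have hlower := F.mul_le_six_mul_sum (m := m) hm (by omega) h01 h12 (by omega) H.eq_zero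
  have hupper : (6 * GradedArtinian.multiplicity I : ℤ) ≤ M 0 * M 1 * M 2 := by
    rw [he]
    have hprod : ∀ q : ℕ, q ≤ M 0 → (q : ℤ) * (b + 2) * (c + 3) ≤ M 0 * M 1 * M 2 := by
      intro q hq
      exact_mod_cast Nat.mul_le_mul (Nat.mul_le_mul hq (hl ▸ hM1)) (hl₂ ▸ hM2)
    -- If M₁ > b the first upper bound suffices. Otherwise all generators have degree b, while m₃ ≥
    -- b+2, so the third difference at b+1 is β₂(b+1) ≥ 0, which is the hypothesis of the second
    -- bound.
    rcases Nat.lt_or_ge b (M 0) with hlt | hge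
    · have h := hprod (b + 1) hlt
      push_cast at h
      exact H.six_mul_sum_le.trans h
    · refine (H.six_mul_sum_le_of_le ?_).trans (hprod b (by omega))
      have d := F.eulerCharacteristic_third_difference ((b + 1 : ℕ) : ℤ) (by omega)
      rw [F.betti_eq_zero (i := 0) fun l => by have := hleM 0 l; omega,
        F.betti_eq_zero (i := 2) fun l => by have := hmle 2 l; omega] at d
      have n1 := F.betti_nonneg 1 ((b + 1 : ℕ) : ℤ)
      have hlt : ∀ z : ℤ, z < m 0 → F.eulerCharacteristic z = GradedArtinian.formsDim z :=
        fun z hz => F.eulerCharacteristic_of_lt_least hmle h01 h12 hz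
      rw [hlt (((b + 1 : ℕ) : ℤ) - 2) (by omega), hlt (((b + 1 : ℕ) : ℤ) - 3) (by omega),
        show ((b + 1 : ℕ) : ℤ) - 1 = (b : ℕ) by push_cast; ring,
        ← F.hVector_eq_eulerCharacteristic, ← F.hVector_eq_eulerCharacteristic] at d
      have f2 := GradedArtinian.two_mul_formsDim (x := ((b + 1 : ℕ) : ℤ) - 2) (by omega)
      have f3 := GradedArtinian.two_mul_formsDim (x := ((b + 1 : ℕ) : ℤ) - 3) (by omega)
      push_cast at d f2 f3 n1 ⊢
      linarith
  rw [← he] at hlower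
  have hlower' : (m 0 * m 1 * m 2 : ℚ) ≤ 6 * GradedArtinian.multiplicity I := by
    exact_mod_cast hlower
  have hupper' : (6 * GradedArtinian.multiplicity I : ℚ) ≤ M 0 * M 1 * M 2 := by
    exact_mod_cast hupper
  constructor
  · linarith
  · linarith
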